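/- Let $p:\mathbb R\to[0,\infty)$ be a probability density that is symmetric around zero, i.e. $p(-x)=p(x)$ for all $x\in\mathbb R$, continuous at $0$ with $p(0)>0$, and that has three continuous bounded derivatives on some interval $(0,x_0)$, $x_0>0$. Put $p_0=p(0)$, $p_1=p'(0+)$, $p_2=p''(0+)$. Let $\theta\in\mathbb R$ and, for $m\ge 2$, let $X_1,\dots,X_m$ be independent real random variables with common density $y\mapsto p(y-\theta)$ and order statistics $X_{(1)}\le\dots\le X_{(m)}$. Let $M_m$ be the sample median, $$M_m=X_{(j)}\ \text{ if } m=2j-1,\qquad M_m=\tfrac12\big(X_{(j)}+X_{(j+1)}\big)\ \text{ if } m=2j,$$ and let $m^*=2[m/2]$, where $[\cdot]$ denotes the integer part. Let $\varphi(x)=(2\pi)^{-1/2}e^{-x^2/2}$, $\Phi(x)=\int_{-\infty}^x\varphi(y)\,dy$ and $$f_1(x)=\frac{p_1x|x|}{4p_0^2}\,\varphi(x),\qquad f_2(x)=\frac x4\Big(3+x^2+\frac{p_2x^2}{6p_0^3}-\frac{p_1^2x^4}{8p_0^4}\Big)\varphi(x).$$ Then for all integers $m\ge 2$ $$\sup_{x\in\mathbb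 R}\left|\mathbb P_\theta\big(2p_0\sqrt{m^*}\,(M_m-\theta)\le x\big)-\Phi(x)-\frac{f_1(x)}{\sqrt{m^*}}-\frac{f_2(x)}{m^*}\right|\le\frac{C_1}{m^{3/2}},$$ where the constant $C_1$ does not depend on $m$ or $\theta$; it depends only on $p_0,p_1,p_2$, on $x_0$, and on an upper bound for $|p'''|$ on $(0,x_0)$. -/

import Mathlib

open MeasureTheory ProbabilityTheory Filter Topology

namespace MedianExpansion

/-- The `k`-th order statistic `v_(k)` (counted from `k = 1` to `k = m`) of `v_1, …, v_m`,
the `k`-th entry of the sample sorted in nondecreasing order. -/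
noncomputable def orderStat {m : ℕ} (v : Fin m → ℝ) (k : ℕ) : ℝ :=
  if h : 1 ≤ k ∧ k ≤ m then v (Tuple.sort v ⟨k - 1, by omega⟩) else 0

/-- The sample median: `v_(j)` if `m = 2 j - 1`, and `(v_(j) + v_(j+1)) / 2` if `m = 2 j`. -/
noncomputable def sampleMedian {m : ℕ} (v : Fin m → ℝ) : ℝ :=
  if Even m then (orderStat v (m / 2) + orderStat v (m / 2 + 1)) / 2
  else orderStat v ((m + 1) / 2)

/-- `m* = 2 [m / 2]` -/
def mStar (m : ℕ) : ℕ := 2 * (m / 2)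

/-- The standard normal density. -/
noncomputable def stdPhi (x : ℝ) : ℝ := gaussianPDFReal 0 1 x

/-- The standard normal distribution function. -/
noncomputable def stdNormalCDF (x : ℝ) : ℝ := cdf (gaussianReal 0 1) x

/-- `p` is a probability density on `ℝ`, symmetric around zero, continuous and positive at zero,
with three continuous bounded derivatives on the interval `(0, x₀)`, `x₀ > 0`. -/
structure AssumptionA (p : ℝ → ℝ) (x₀ : ℝ) : Prop where
  measurable : Measurable p
  nonneg : ∀ x, 0 ≤ p x
  lintegral_eq_one : ∫⁻ x, ENNReal.ofReal (p x) = 1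
  symmetric : ∀ x, p (-x) = p x
  pos_zero : 0 < p 0
  continuousAt_zero : ContinuousAt p 0
  x₀_pos : 0 < x₀
  contDiffOn : ContDiffOn ℝ 3 p (Set.Ioo 0 x₀)
  bounded : ∀ k : ℕ, 1 ≤ k → k ≤ 3 → ∃ K : ℝ, ∀ x ∈ Set.Ioo 0 x₀, |iteratedDeriv k p x| ≤ K

/-- `f₁(x) = p₁ x |x| φ(x) / (4 p₀²)` -/
noncomputable def f₁ (p₀ p₁ : ℝ) (x : ℝ) : ℝ :=
  p₁ * x * |x| / (4 * p₀ ^ 2) * stdPhi x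

/-- `f₂(x) = (x / 4) (3 + x² + p₂ x² / (6 p₀³) - p₁² x⁴ / (8 p₀⁴)) φ(x)` -/
noncomputable def f₂ (p₀ p₁ p₂ : ℝ) (x : ℝ) : ℝ :=
  x / 4 * (3 + x ^ 2 + p₂ * x ^ 2 / (6 * p₀ ^ 3) - p₁ ^ 2 * x ^ 4 / (8 * p₀ ^ 4)) * stdPhi x

end MedianExpansion

/-! Write `n = m* = 2k`, let `F` be the distribution function of `p`, and put `t = x / (2 p₀ √n)`,
`q = F t`. The proof compares the law of the median with the symmetric incomplete beta function
`medianBeta k q`, and then expands that function.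

If `m = 2k+1`, the median is at most `θ + t` exactly when at least `k+1` observations are, so the
probability equals `medianBeta k q` with no error (`binomTail_odd_eq_medianBeta`). If `m = 2k`, let
`N` be the number of observations that are at most `θ + t`. By `binomTail_even_add_eq_medianBeta`,
`medianBeta k q = P(N ≥ k+1) + q P(N = k)`, so it remains to see that, on `N = k`, the median falls
below `θ + t` with conditional probability close to `q`. Fix the set `S` of the `k` lower indices:
the maximum over `S` and the minimum over its complement are independent, and the probability that
their average exceeds the level is a one-dimensional integral. Near the centre `F` is almost
symmetric about each point, up to a squared increment, because `p` is Lipschitz there. This replaces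
the integral by the one for the uniform law, which is nearly an exact derivative. The error is
`O(1/k) 4^(-k)` for each `S`, and `centralBinom_le` bounds the number of sets by `4^k / √(2k+1)`, so
the total is `O(k^(-3/2))`. Away from the centre everything is exponentially small. Hence both
parities share one expansion in `m*`.

For the expansion put `y = √n (2q - 1)`. The derivative of `medianBeta k` in `y` is a constant times
`(1 - y²/n)^k`, which is `exp(-y²/2) (1 - y⁴/(4n))` up to an integrable `O(n⁻²)`; the constant is
found from total mass rather than from Stirling's formula (`exists_abs_medianBeta_sub_le`). Taylor
expansion of `F` at `0+` gives `y = x + α x²/√n + β x³/n + O(x⁴ n^(-3/2))` with `α = p₁/(4p₀²)`, `β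
= p₂/(24p₀³)`, and substitution into `Φ(y) + (y³+3y)φ(y)/(4n)` yields `f₁` and `f₂`
(`exists_abs_expansion_sub_le`). Large `x` follows by monotonicity and negative `x` by symmetry. All
constants are chosen before `p`, which gives the asserted uniformity. -/

namespace MedianExpansion

/-! ### Binomial tails and the symmetric incomplete beta function -/

/-- The probability that a binomial variable with parameters `N` and `q` is at least `r`. -/
noncomputable def binomTail (N r : ℕ) (q : ℝ) : ℝ :=
  ∑ j ∈ Finset.Icc r N, (N.choose j : ℝ) * q ^ j * (1 - q) ^ (N - j)

lemma eval_bernsteinPolynomial (N j : ℕ) (q : ℝ) :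
    (bernsteinPolynomial ℝ N j).eval q = (N.choose j : ℝ) * q ^ j * (1 - q) ^ (N - j) := by
  simp [bernsteinPolynomial]

/-- The derivatives of the Bernstein polynomials telescope, so only the lowest term survives. -/
lemma hasDerivAt_binomTail {N r : ℕ} (hr : r < N) (q : ℝ) :
    HasDerivAt (binomTail N (r + 1))
      (N * (((N - 1).choose r : ℝ) * q ^ r * (1 - q) ^ (N - 1 - r))) q := by
  have h1 : binomTail N (r + 1) =
      fun q => (∑ ν ∈ Finset.Ico r N, bernsteinPolynomial ℝ N (ν + 1)).eval q := by
    funext q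
    rw [Polynomial.eval_finsetSum, binomTail]
    have : Finset.Icc (r + 1) N = Finset.Ico (r + 1) (N + 1) := rfl
    rw [this, ← Finset.sum_Ico_add']
    exact Finset.sum_congr rfl fun ν _ => (eval_bernsteinPolynomial _ _ _).symm
  rw [h1]
  refine (Polynomial.hasDerivAt (∑ ν ∈ Finset.Ico r N, bernsteinPolynomial ℝ N (ν + 1)) q).congr_deriv ?_
  rw [Polynomial.derivative_sum]
  simp only [bernsteinPolynomial.derivative_succ]
  rw [← Finset.mul_sum]
  have h2 : ∑ i ∈ Finset.Ico r N, (bernsteinPolynomial ℝ (N - 1) i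
      - bernsteinPolynomial ℝ (N - 1) (i + 1)) = bernsteinPolynomial ℝ (N - 1) r := by
    rw [← neg_inj, ← Finset.sum_neg_distrib]
    simp only [neg_sub]
    rw [Finset.sum_Ico_sub _ hr.le, bernsteinPolynomial.eq_zero_of_lt ℝ (by omega : N - 1 < N)]
    simp
  rw [h2, Polynomial.eval_mul, eval_bernsteinPolynomial]
  simp

/-- The distribution function of the median of `2 k + 1` independent uniform variables. -/
noncomputable def medianBeta (k : ℕ) (q : ℝ) : ℝ :=
  (2 * k + 1) * (k.centralBinom : ℝ) * ∫ u in (0 : ℝ)..q, (u * (1 - u)) ^ k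

lemma hasDerivAt_medianBeta (k : ℕ) (q : ℝ) :
    HasDerivAt (medianBeta k) ((2 * k + 1) * (k.centralBinom : ℝ) * (q * (1 - q)) ^ k) q := by
  have hc : Continuous fun u : ℝ => (u * (1 - u)) ^ k := by fun_prop
  exact (intervalIntegral.integral_hasDerivAt_right (hc.intervalIntegrable _ _)
    (hc.stronglyMeasurableAtFilter _ _) hc.continuousAt).const_mul _

lemma medianBeta_zero (k : ℕ) : medianBeta k 0 = 0 := by simp [medianBeta]

lemma eq_of_hasDerivAt_eq {f g f' : ℝ → ℝ} (hf : ∀ x, HasDerivAt f (f' x) x)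
    (hg : ∀ x, HasDerivAt g (f' x) x) {a : ℝ} (h : f a = g a) : f = g := by
  have hd : ∀ x, HasDerivAt (f - g) 0 x := fun x => by simpa using (hf x).sub (hg x)
  funext x
  have := is_const_of_deriv_eq_zero (fun x => (hd x).differentiableAt) (fun x => (hd x).deriv) x a
  simp only [Pi.sub_apply, h, sub_self] at this
  linarith

lemma binomTail_zero (N r : ℕ) : binomTail N (r + 1) 0 = 0 := by
  refine Finset.sum_eq_zero fun j hj => ?_
  have : j ≠ 0 := by simp at hj; omega
  simp [this]

lemma binomTail_odd_eq_medianBeta (k : ℕ) (q : ℝ) :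
    binomTail (2 * k + 1) (k + 1) q = medianBeta k q := by
  refine congrFun (eq_of_hasDerivAt_eq (a := 0) (fun x => hasDerivAt_binomTail (by omega) x)
    (fun x => ?_) ?_) q
  · refine (hasDerivAt_medianBeta k x).congr_deriv ?_
    have h1 : 2 * k + 1 - 1 = 2 * k := by omega
    have h2 : 2 * k - k = k := by omega
    rw [h1, h2, Nat.centralBinom_eq_two_mul_choose, mul_pow]
    push_cast; ring
  · rw [medianBeta_zero, binomTail_zero]

/-- Adding one more observation to `2k` of them, at least `k+1` of the `2k+1` lie below the level
iff at least `k+1` of the first `2k` do, or exactly `k` of them do together with the new one. The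
proof checks that both sides have the same derivative and vanish at `0`. -/
lemma binomTail_even_add_eq_medianBeta {k : ℕ} (hk : 1 ≤ k) (q : ℝ) :
    binomTail (2 * k) (k + 1) q + k.centralBinom * (q * (q * (1 - q)) ^ k) = medianBeta k q := by
  obtain ⟨l, rfl⟩ : ∃ l, k = l + 1 := ⟨k - 1, by omega⟩
  have hd : ∀ x : ℝ, HasDerivAt (fun q => binomTail (2 * (l + 1)) (l + 1 + 1) q
      + (l + 1).centralBinom * (q * (q * (1 - q)) ^ (l + 1)))
      ((2 * (l + 1 : ℕ) + 1) * ((l + 1).centralBinom : ℝ) * (x * (1 - x)) ^ (l + 1)) x := by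
    intro x
    have e := hasDerivAt_binomTail (N := 2 * (l + 1)) (r := l + 1) (by omega) x
    have e2 : HasDerivAt (fun q : ℝ => (q * (q * (1 - q)) ^ (l + 1)))
        (1 * (x * (1 - x)) ^ (l + 1) + x * (((l + 1 : ℕ) : ℝ) * (x * (1 - x)) ^ (l + 1 - 1)
          * (1 * (1 - x) + x * (0 - 1)))) x :=
      (hasDerivAt_id' x).mul ((HasDerivAt.mul (hasDerivAt_id' x)
        ((hasDerivAt_const x (1 : ℝ)).sub (hasDerivAt_id' x))).pow (l + 1))
    refine (e.add (e2.const_mul ((l + 1).centralBinom : ℝ))).congr_deriv ?_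
    have h1 : 2 * (l + 1) - 1 = 2 * l + 1 := by omega
    have h2 : 2 * l + 1 - (l + 1) = l := by omega
    have h3 : ((l + 1).centralBinom : ℝ) = 2 * ((2 * l + 1).choose (l + 1) : ℝ) := by
      rw [Nat.centralBinom_eq_two_mul_choose]
      have : (2 * (l + 1)).choose (l + 1) = 2 * (2 * l + 1).choose (l + 1) := by
        rw [show 2 * (l + 1) = (2 * l + 1) + 1 by ring, Nat.choose_succ_succ,
          Nat.choose_symm_half]
        ring
      exact_mod_cast this
    rw [h1, h2, h3, Nat.add_sub_cancel, mul_pow, mul_pow]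
    push_cast
    ring
  refine congrFun (eq_of_hasDerivAt_eq (a := 0) hd (hasDerivAt_medianBeta (l + 1)) ?_) q
  rw [medianBeta_zero, binomTail_zero]; simp

lemma medianBeta_one (k : ℕ) : medianBeta k 1 = 1 := by
  rw [← binomTail_odd_eq_medianBeta, binomTail]
  rw [Finset.sum_eq_single (2 * k + 1)]
  · simp
  · intro b hb hb'
    have : 2 * k + 1 - b ≠ 0 := by simp at hb; omega
    simp [this]
  · intro h; simp at h; omega

lemma medianBeta_one_sub (k : ℕ) (q : ℝ) : medianBeta k (1 - q) = 1 - medianBeta k q := by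
  refine congrFun (eq_of_hasDerivAt_eq (f := fun q => medianBeta k (1 - q))
    (g := fun q => 1 - medianBeta k q) (a := 0)
    (f' := fun q => -((2 * k + 1) * (k.centralBinom : ℝ) * (q * (1 - q)) ^ k)) ?_ ?_ ?_) q
  · intro x
    have h := (hasDerivAt_medianBeta k (1 - x)).comp_const_sub 1 x
    refine h.congr_deriv ?_
    ring_nf
  · intro x
    exact (hasDerivAt_medianBeta k x).const_sub 1
  · simp [medianBeta_zero, medianBeta_one]

lemma medianBeta_half (k : ℕ) : medianBeta k (1 / 2) = 1 / 2 := by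
  have := medianBeta_one_sub k (1 / 2)
  norm_num at this ⊢
  linarith

lemma medianBeta_mono (k : ℕ) : MonotoneOn (medianBeta k) (Set.Icc 0 1) := by
  refine monotoneOn_of_deriv_nonneg (convex_Icc 0 1)
    (fun x _ => (hasDerivAt_medianBeta k x).continuousAt.continuousWithinAt)
    (fun x _ => (hasDerivAt_medianBeta k x).differentiableAt.differentiableWithinAt) fun x hx => ?_
  rw [interior_Icc] at hx
  rw [(hasDerivAt_medianBeta k x).deriv]
  have : 0 ≤ x * (1 - x) := mul_nonneg hx.1.le (by linarith [hx.2])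
  positivity

/-- The ratio of consecutive left-hand sides is `4(2k+1)(2k+3)/(k+1)²`, which is below `16` since
`(2k+1)(2k+3) < 4(k+1)²`. This gives the order `4^k/√k` without Stirling's formula. -/
lemma centralBinom_sq_mul_le (k : ℕ) : ((k.centralBinom : ℝ)) ^ 2 * (2 * k + 1) ≤ 16 ^ k := by
  induction k with
  | zero => simp
  | succ k ih =>
    have h : ((k : ℝ) + 1) * ((k + 1).centralBinom : ℝ) = 2 * (2 * k + 1) * k.centralBinom := by
      exact_mod_cast Nat.succ_mul_centralBinom_succ k
    have h1 : ((k + 1).centralBinom : ℝ) = 2 * (2 * k + 1) * k.centralBinom / (k + 1) := by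
      field_simp; linarith
    rw [h1, pow_succ (16 : ℝ)]
    have : (2 * (2 * (k : ℝ) + 1) * (k.centralBinom : ℝ) / (k + 1)) ^ 2 * (2 * ((k + 1 : ℕ) : ℝ) + 1)
        = ((k.centralBinom : ℝ) ^ 2 * (2 * k + 1)) *
          (4 * (2 * k + 1) * (2 * k + 3) / (k + 1) ^ 2) := by
      push_cast; field_simp; ring
    rw [this]
    refine mul_le_mul ih ?_ (by positivity) (by positivity)
    rw [div_le_iff₀ (by positivity)]
    nlinarith

lemma centralBinom_le (k : ℕ) : (k.centralBinom : ℝ) * √(2 * k + 1) ≤ 4 ^ k := by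
  refine le_of_sq_le_sq ?_ (by positivity)
  rw [mul_pow, Real.sq_sqrt (by positivity), ← pow_mul, mul_comm k 2, pow_mul]
  norm_num
  exact centralBinom_sq_mul_le k

/-! ### The standard normal distribution -/

lemma stdPhi_eq (x : ℝ) : stdPhi x = (√(2 * Real.pi))⁻¹ * Real.exp (-(x ^ 2 / 2)) := by
  simp only [stdPhi, gaussianPDFReal, NNReal.coe_one, mul_one, sub_zero]
  ring_nf

lemma stdPhi_nonneg (x : ℝ) : 0 ≤ stdPhi x := by rw [stdPhi_eq]; positivity

lemma stdPhi_neg (x : ℝ) : stdPhi (-x) = stdPhi x := by simp [stdPhi_eq]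

lemma stdPhi_le_exp (x : ℝ) : stdPhi x ≤ Real.exp (-(x ^ 2 / 2)) := by
  rw [stdPhi_eq]
  refine mul_le_of_le_one_left (Real.exp_pos _).le (inv_le_one_of_one_le₀ ?_)
  rw [Real.one_le_sqrt]
  linarith [Real.pi_gt_three]

lemma hasDerivAt_stdPhi (x : ℝ) : HasDerivAt stdPhi (-x * stdPhi x) x := by
  have h : stdPhi = fun x => (√(2 * Real.pi))⁻¹ * Real.exp (-(x ^ 2 / 2)) := funext stdPhi_eq
  rw [stdPhi_eq, h]
  have h1 : HasDerivAt (fun x : ℝ => -(x ^ 2 / 2)) (-x) x :=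
    (((hasDerivAt_pow 2 x).div_const 2).neg).congr_deriv (by simp)
  exact (h1.exp.const_mul _).congr_deriv (by ring)

lemma continuous_stdPhi : Continuous stdPhi :=
  continuous_iff_continuousAt.2 fun x => (hasDerivAt_stdPhi x).continuousAt

lemma stdNormalCDF_eq_integral (x : ℝ) : stdNormalCDF x = ∫ y in Set.Iic x, stdPhi y := by
  rw [stdNormalCDF, cdf_eq_real, measureReal_def,
    gaussianReal_apply_eq_integral 0 one_ne_zero, ENNReal.toReal_ofReal]
  · rfl
  · exact setIntegral_nonneg measurableSet_Iic fun y _ => gaussianPDFReal_nonneg _ _ _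

lemma hasDerivAt_stdNormalCDF (x : ℝ) : HasDerivAt stdNormalCDF (stdPhi x) x := by
  have hi : Integrable stdPhi := integrable_gaussianPDFReal 0 1
  have h : stdNormalCDF = fun x => stdNormalCDF 0 + ∫ y in (0 : ℝ)..x, stdPhi y := by
    funext x
    rw [stdNormalCDF_eq_integral, stdNormalCDF_eq_integral,
      ← intervalIntegral.integral_Iic_sub_Iic hi.integrableOn hi.integrableOn]
    ring
  rw [h]
  exact (intervalIntegral.integral_hasDerivAt_right (continuous_stdPhi.intervalIntegrable _ _)
    (continuous_stdPhi.stronglyMeasurableAtFilter _ _) continuous_stdPhi.continuousAt).const_add _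

lemma stdNormalCDF_nonneg (x : ℝ) : 0 ≤ stdNormalCDF x := cdf_nonneg _ _

lemma stdNormalCDF_le_one (x : ℝ) : stdNormalCDF x ≤ 1 := cdf_le_one _ _

lemma stdNormalCDF_neg (x : ℝ) : stdNormalCDF (-x) = 1 - stdNormalCDF x := by
  have hi : Integrable stdPhi := integrable_gaussianPDFReal 0 1
  have h1 : ∫ y, stdPhi y = 1 := integral_gaussianPDFReal_eq_one 0 one_ne_zero
  rw [stdNormalCDF_eq_integral, stdNormalCDF_eq_integral, ← h1,
    ← integral_add_compl measurableSet_Iic hi (s := Set.Iic x), Set.compl_Iic,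
    ← integral_comp_neg_Ioi]
  simp [stdPhi_neg]

lemma stdNormalCDF_zero : stdNormalCDF 0 = 1 / 2 := by
  have := stdNormalCDF_neg 0
  simp only [neg_zero] at this
  linarith

/-- The difference of the two sides is nondecreasing on `[1, ∞)` and tends to `0`, hence is
nonpositive. -/
lemma one_sub_stdNormalCDF_le {x : ℝ} (hx : 1 ≤ x) :
    1 - stdNormalCDF x ≤ Real.exp (-(x ^ 2 / 2)) := by
  set D : ℝ → ℝ := fun x => 1 - stdNormalCDF x - Real.exp (-(x ^ 2 / 2)) with hD
  have hd : ∀ x, HasDerivAt D (-stdPhi x + x * Real.exp (-(x ^ 2 / 2))) x := by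
    intro x
    have h1 : HasDerivAt (fun x : ℝ => -(x ^ 2 / 2)) (-x) x :=
      (((hasDerivAt_pow 2 x).div_const 2).neg).congr_deriv (by simp)
    exact (((hasDerivAt_stdNormalCDF x).const_sub 1).sub h1.exp).congr_deriv (by ring)
  have hm : MonotoneOn D (Set.Ici 1) := by
    refine monotoneOn_of_deriv_nonneg (convex_Ici 1)
      (fun x _ => (hd x).continuousAt.continuousWithinAt)
      (fun x _ => (hd x).differentiableAt.differentiableWithinAt) fun x hx => ?_
    rw [interior_Ici] at hx
    rw [(hd x).deriv]
    have h1 := stdPhi_le_exp x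
    have h2 : Real.exp (-(x ^ 2 / 2)) ≤ x * Real.exp (-(x ^ 2 / 2)) :=
      le_mul_of_one_le_left (Real.exp_pos _).le (le_of_lt hx)
    linarith
  have h1 : Tendsto stdNormalCDF atTop (𝓝 1) := tendsto_cdf_atTop _
  have h2 : Tendsto (fun x : ℝ => Real.exp (-(x ^ 2 / 2))) atTop (𝓝 0) := by
    refine Real.tendsto_exp_neg_atTop_nhds_zero.comp ?_
    exact (tendsto_pow_atTop two_ne_zero).atTop_div_const two_pos
  have h3 : Tendsto D atTop (𝓝 0) := by
    simpa using (h1.const_sub 1).sub h2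
  have h4 : D x ≤ 0 := by
    refine ge_of_tendsto h3 ?_
    filter_upwards [eventually_ge_atTop x] with y hy
    exact hm hx (le_trans hx hy) hy
  simp only [hD] at h4
  linarith

/-- Combine `x^j ≤ j! e^x` with `x - c x² ≤ 1/c - x`, a completed square. The factor `exp(-x)` is
kept so that the bound can be integrated over an interval of any length. -/
lemma exists_pow_mul_exp_le (j : ℕ) {c : ℝ} (hc : 0 < c) :
    ∃ C, 0 < C ∧ ∀ x : ℝ, 0 ≤ x → x ^ j * Real.exp (-(c * x ^ 2)) ≤ C * Real.exp (-x) := by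
  refine ⟨j.factorial * Real.exp (1 / c), by positivity, fun x hx => ?_⟩
  have h1 : x ^ j ≤ j.factorial * Real.exp x := by
    have := Real.pow_div_factorial_le_exp x hx j
    rwa [div_le_iff₀' (by positivity)] at this
  calc x ^ j * Real.exp (-(c * x ^ 2))
      ≤ (j.factorial * Real.exp x) * Real.exp (-(c * x ^ 2)) := by gcongr
    _ = j.factorial * Real.exp (x + -(c * x ^ 2)) := by rw [Real.exp_add]; ring
    _ ≤ j.factorial * Real.exp (1 / c + -x) := by
        refine mul_le_mul_of_nonneg_left (Real.exp_le_exp.2 ?_) (by positivity)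
        have : 0 ≤ (c * x - 1) ^ 2 / c := by positivity
        have h : (c * x - 1) ^ 2 / c = c * x ^ 2 - 2 * x + 1 / c := by
          field_simp; ring
        linarith
    _ = _ := by rw [Real.exp_add]; ring

lemma exists_pow_mul_exp_le' (j : ℕ) {c : ℝ} (hc : 0 < c) :
    ∃ C, 0 < C ∧ ∀ x : ℝ, 0 ≤ x → x ^ j * Real.exp (-(c * x ^ 2)) ≤ C := by
  obtain ⟨C, hC, h⟩ := exists_pow_mul_exp_le j hc
  exact ⟨C, hC, fun x hx => (h x hx).trans (mul_le_of_le_one_right hC.le (by simpa using hx))⟩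

/-! ### The expansion of the symmetric incomplete beta function -/

lemma abs_exp_neg_sub_exp_neg_le {a b : ℝ} (ha : 0 ≤ a) (hb : 0 ≤ b) :
    |Real.exp (-a) - Real.exp (-b)| ≤ |a - b| := by
  have key : ∀ a b : ℝ, 0 ≤ a → a ≤ b → |Real.exp (-a) - Real.exp (-b)| ≤ |a - b| := by
    intro a b ha hab
    rw [abs_of_nonneg (by simpa using hab), abs_sub_comm, abs_of_nonneg (by linarith)]
    have h1 : Real.exp (-b) = Real.exp (-a) * Real.exp (-(b - a)) := by
      rw [← Real.exp_add]; ring_nf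
    have h2 := Real.one_sub_le_exp_neg (b - a)
    have h3 : Real.exp (-a) ≤ 1 := by simpa using ha
    rw [h1]
    nlinarith [Real.exp_pos (-a), Real.exp_le_one_iff.2 (show -(b - a) ≤ 0 by linarith)]
  rcases le_total a b with h | h
  · exact key a b ha h
  · rw [abs_sub_comm, abs_sub_comm a]; exact key b a hb h

lemma abs_exp_neg_sub_le {w : ℝ} (hw : 0 ≤ w) : |Real.exp (-w) - (1 - w)| ≤ w ^ 2 := by
  have h1 := Real.one_sub_le_exp_neg w
  have h2 : Real.exp (-w) ≤ 1 - w + w ^ 2 := by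
    rw [Real.exp_neg]
    refine inv_le_of_inv_le₀ (by nlinarith) ?_
    refine le_trans ?_ (Real.add_one_le_exp w)
    rw [inv_le_iff_one_le_mul₀ (by nlinarith)]
    nlinarith [pow_nonneg hw 3]
  rw [abs_of_nonneg (by linarith)]
  linarith

/-- Write `(1-r)^k = exp(-kr) exp(-w)` with `w = -k (log(1-r) + r)`, which is `k r²/2` up to `2k r³`
when `r < 1/2`, and then linearise the second exponential. -/
lemma abs_one_sub_pow_sub_le (k : ℕ) {r : ℝ} (h0 : 0 ≤ r) (h1 : r ≤ 1) :
    |(1 - r) ^ k - Real.exp (-(k * r)) * (1 - k * r ^ 2 / 2)| ≤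
      Real.exp (-(k * r)) * (2 * k * r ^ 3 + 4 * r ^ 2 + (k * r ^ 2 / 2) ^ 2) := by
  set w₀ : ℝ := k * r ^ 2 / 2
  have hw₀ : 0 ≤ w₀ := by positivity
  suffices H : |(1 - r) ^ k - Real.exp (-(k * r)) * Real.exp (-w₀)| ≤
      Real.exp (-(k * r)) * (2 * k * r ^ 3 + 4 * r ^ 2) by
    have h2 : |Real.exp (-(k * r)) * Real.exp (-w₀) - Real.exp (-(k * r)) * (1 - w₀)| ≤
        Real.exp (-(k * r)) * w₀ ^ 2 := by
      rw [← mul_sub, abs_mul, abs_of_pos (Real.exp_pos _)]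
      exact mul_le_mul_of_nonneg_left (abs_exp_neg_sub_le hw₀) (Real.exp_pos _).le
    calc _ ≤ _ := abs_sub_le _ (Real.exp (-(k * r)) * Real.exp (-w₀)) _
      _ ≤ _ := add_le_add H h2
      _ = _ := by ring
  rcases lt_or_ge r (1 / 2) with hr | hr
  · set w : ℝ := -(k * (Real.log (1 - r) + r)) with hw
    have hpos : 0 < 1 - r := by linarith
    have e : (1 - r) ^ k = Real.exp (-(k * r)) * Real.exp (-w) := by
      rw [← Real.exp_add, hw, ← Real.exp_log (pow_pos hpos k), Real.log_pow]
      ring_nf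
    have hwn : 0 ≤ w := by
      have := Real.log_le_sub_one_of_pos hpos
      rw [hw, ← mul_neg]
      exact mul_nonneg (by positivity) (by linarith)
    have hww : |w - w₀| ≤ 2 * k * r ^ 3 := by
      have := Real.abs_log_sub_add_sum_range_le (x := r) (by rw [abs_of_nonneg h0]; linarith) 2
      simp only [Finset.sum_range_succ, Finset.sum_range_zero, abs_of_nonneg h0] at this
      have e2 : w - w₀ = -(k * (0 + r ^ (0 + 1) / ((0 : ℕ) + 1) + r ^ (1 + 1) / ((1 : ℕ) + 1)
          + Real.log (1 - r))) := by
        simp only [hw, w₀]; push_cast; ring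
      rw [e2, abs_neg, abs_mul, abs_of_nonneg (Nat.cast_nonneg k)]
      have h3 : r ^ (2 + 1) / (1 - r) ≤ 2 * r ^ 3 := by
        rw [div_le_iff₀ hpos]
        have : 0 ≤ r ^ 3 := by positivity
        norm_num
        nlinarith
      calc _ ≤ (k : ℝ) * (2 * r ^ 3) := by gcongr; exact this.trans h3
        _ = _ := by ring
    rw [e, ← mul_sub, abs_mul, abs_of_pos (Real.exp_pos _)]
    refine mul_le_mul_of_nonneg_left ?_ (Real.exp_pos _).le
    have := abs_exp_neg_sub_exp_neg_le hwn hw₀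
    nlinarith [sq_nonneg r]
  -- For `r ≥ 1/2` the term `4 r²` is at least `1`, and both quantities compared lie between `0` and
  -- `exp(-kr)`.
  · have e1 : (1 - r) ^ k ≤ Real.exp (-(k * r)) := by
      have : Real.exp (-(k * r)) = Real.exp (-r) ^ k := by
        rw [← Real.exp_nat_mul]; ring_nf
      rw [this]
      exact pow_le_pow_left₀ (by linarith) (Real.one_sub_le_exp_neg r) k
    have e2 : Real.exp (-(k * r)) * Real.exp (-w₀) ≤ Real.exp (-(k * r)) :=
      mul_le_of_le_one_right (Real.exp_pos _).le (by simpa using hw₀)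
    have e3 : 0 ≤ (1 - r) ^ k := pow_nonneg (by linarith) k
    have e4 : 0 ≤ Real.exp (-(k * r)) * Real.exp (-w₀) := by positivity
    have e5 : Real.exp (-(k * r)) ≤ Real.exp (-(k * r)) * (2 * k * r ^ 3 + 4 * r ^ 2) := by
      refine le_mul_of_one_le_right (Real.exp_pos _).le ?_
      have : (0 : ℝ) ≤ 2 * k * r ^ 3 := by positivity
      nlinarith
    rw [abs_le]
    constructor <;> linarith

lemma exists_abs_one_sub_pow_sub_le :
    ∃ C, 0 < C ∧ ∀ k : ℕ, 1 ≤ k → ∀ z : ℝ, 0 ≤ z → z ^ 2 ≤ 2 * k →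
      |(1 - z ^ 2 / (2 * k)) ^ k - Real.exp (-(z ^ 2 / 2)) * (1 - z ^ 4 / (4 * (2 * k)))| ≤
        C * Real.exp (-z) / (2 * k) ^ 2 := by
  obtain ⟨C4, h4, H4⟩ := exists_pow_mul_exp_le 4 (c := 1 / 2) (by norm_num)
  obtain ⟨C6, h6, H6⟩ := exists_pow_mul_exp_le 6 (c := 1 / 2) (by norm_num)
  obtain ⟨C8, h8, H8⟩ := exists_pow_mul_exp_le 8 (c := 1 / 2) (by norm_num)
  refine ⟨C6 + 4 * C4 + C8, by positivity, fun k hk z hz hzk => ?_⟩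
  have hk0 : (0 : ℝ) < k := by exact_mod_cast hk
  have h := abs_one_sub_pow_sub_le k (r := z ^ 2 / (2 * k)) (by positivity)
    ((div_le_one (by positivity)).2 hzk)
  have e1 : (k : ℝ) * (z ^ 2 / (2 * k)) = z ^ 2 / 2 := by field_simp
  have e2 : (k : ℝ) * (z ^ 2 / (2 * k)) ^ 2 / 2 = z ^ 4 / (4 * (2 * k)) := by field_simp; ring
  rw [e2, e1] at h
  refine h.trans ?_
  rw [le_div_iff₀ (by positivity)]
  have H4' := H4 z hz
  have H6' := H6 z hz
  have H8' := H8 z hz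
  rw [show (1 / 2 * z ^ 2) = z ^ 2 / 2 by ring] at H4' H6' H8'
  have e3 : Real.exp (-(z ^ 2 / 2)) * (2 * k * (z ^ 2 / (2 * k)) ^ 3 + 4 * (z ^ 2 / (2 * k)) ^ 2
      + (z ^ 4 / (4 * (2 * k))) ^ 2) * (2 * k) ^ 2 =
      z ^ 6 * Real.exp (-(z ^ 2 / 2)) + 4 * (z ^ 4 * Real.exp (-(z ^ 2 / 2)))
        + (z ^ 8 * Real.exp (-(z ^ 2 / 2))) / 16 := by
    field_simp; ring
  rw [e3]
  have : 0 ≤ z ^ 8 * Real.exp (-(z ^ 2 / 2)) := by positivity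
  linarith

/-- The total integral of `C exp(-x)` over the half-line is `C`, so the bound does not grow with
`b`; it will be used with `b = √n`. -/
lemma abs_sub_le_of_abs_deriv_le_exp {D D' : ℝ → ℝ} {C b : ℝ} (hd : ∀ x, HasDerivAt D (D' x) x)
    (hC : 0 ≤ C) (h : ∀ x, 0 ≤ x → x ≤ b → |D' x| ≤ C * Real.exp (-x)) {y : ℝ} (hy : 0 ≤ y)
    (hyb : y ≤ b) : |D y - D 0| ≤ C := by
  have hB : ∀ x : ℝ, HasDerivAt (fun x => -(C * Real.exp (-x))) (C * Real.exp (-x)) x := fun x =>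
    ((((hasDerivAt_neg x).exp).const_mul C).neg).congr_deriv (by ring)
  have hm1 : MonotoneOn (fun x => -(C * Real.exp (-x)) - D x) (Set.Icc 0 b) := by
    refine monotoneOn_of_deriv_nonneg (convex_Icc 0 b)
      (fun x _ => ((hB x).sub (hd x)).continuousAt.continuousWithinAt)
      (fun x _ => ((hB x).sub (hd x)).differentiableAt.differentiableWithinAt) fun x hx => ?_
    rw [interior_Icc] at hx
    refine (((hB x).sub (hd x)).deriv).symm ▸ ?_
    linarith [(abs_le.1 (h x hx.1.le hx.2.le)).2]
  have hm2 : MonotoneOn (fun x => -(C * Real.exp (-x)) + D x) (Set.Icc 0 b) := by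
    refine monotoneOn_of_deriv_nonneg (convex_Icc 0 b)
      (fun x _ => ((hB x).add (hd x)).continuousAt.continuousWithinAt)
      (fun x _ => ((hB x).add (hd x)).differentiableAt.differentiableWithinAt) fun x hx => ?_
    rw [interior_Icc] at hx
    refine (((hB x).add (hd x)).deriv).symm ▸ ?_
    linarith [(abs_le.1 (h x hx.1.le hx.2.le)).1]
  have h1 := hm1 ⟨le_rfl, hy.trans hyb⟩ ⟨hy, hyb⟩ hy
  have h2 := hm2 ⟨le_rfl, hy.trans hyb⟩ ⟨hy, hyb⟩ hy
  simp only [neg_zero, Real.exp_zero, mul_one] at h1 h2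
  have : 0 ≤ C * Real.exp (-y) := by positivity
  rw [abs_le]
  constructor <;> linarith

/-- The second order expansion of the distribution function of the median of `n + 1` uniform
variables, in the standardised variable. -/
noncomputable def uniformExpansion (n y : ℝ) : ℝ :=
  stdNormalCDF y + (y ^ 3 + 3 * y) * stdPhi y / (4 * n)

/-- The cubic `y³ + 3y` is the one for which `(y³ + 3y) φ` is an antiderivative of `(3 - y⁴) φ`. -/
lemma hasDerivAt_uniformExpansion (n y : ℝ) :
    HasDerivAt (uniformExpansion n) (stdPhi y * (1 + (3 - y ^ 4) / (4 * n))) y := by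
  have h1 : HasDerivAt (fun y : ℝ => y ^ 3 + 3 * y) (3 * y ^ 2 + 3) y :=
    ((hasDerivAt_pow 3 y).add ((hasDerivAt_id' y).const_mul 3)).congr_deriv (by norm_num)
  exact ((hasDerivAt_stdNormalCDF y).add ((h1.mul (hasDerivAt_stdPhi y)).div_const (4 * n))
    ).congr_deriv (by ring)

/-- The two derivatives agree to order `n⁻²` up to an unknown ratio `ρ` of normalising constants.
Integrating over the whole range `[0, √n]`, where both functions increase from `1/2` to nearly `1`,
forces `ρ = 1 + O(n⁻²)`. -/
lemma exists_abs_medianBeta_sub_le :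
    ∃ C, 0 < C ∧ ∀ k : ℕ, 1 ≤ k → ∀ y : ℝ, 0 ≤ y → y ≤ √(2 * k) →
      |medianBeta k (1 / 2 + y / (2 * √(2 * k))) - uniformExpansion (2 * k) y| ≤
        C / (2 * k) ^ 2 := by
  obtain ⟨C₁, hC₁, H₁⟩ := exists_abs_one_sub_pow_sub_le
  obtain ⟨C4, h4, H4⟩ := exists_pow_mul_exp_le 4 (c := 1 / 2) (by norm_num)
  obtain ⟨E4, he4, HE4⟩ := exists_pow_mul_exp_le' 4 (c := 1 / 2) (by norm_num)
  obtain ⟨E5, he5, HE5⟩ := exists_pow_mul_exp_le' 5 (c := 1 / 2) (by norm_num)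
  obtain ⟨E3, he3, HE3⟩ := exists_pow_mul_exp_le' 3 (c := 1 / 2) (by norm_num)
  set A : ℝ := C4 + 2 * C₁
  set E : ℝ := E4 + E5 + E3
  refine ⟨A + 3 * (A + E), by positivity, fun k hk y hy0 hyb => ?_⟩
  have hk0 : (1 : ℝ) ≤ k := by exact_mod_cast hk
  set n : ℝ := 2 * k with hn
  have hn1 : 1 ≤ n := by linarith
  have hn0 : 0 < n := by linarith
  have hs : √n ^ 2 = n := Real.sq_sqrt hn0.le
  have hs0 : 0 < √n := Real.sqrt_pos.2 hn0
  have hs1 : 1 ≤ √n := Real.one_le_sqrt.2 hn1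
  set g : ℝ → ℝ := fun y => medianBeta k (1 / 2 + y / (2 * √n)) with hg
  set c : ℝ := (2 * k + 1) * (k.centralBinom : ℝ) * (1 / 4) ^ k / (2 * √n) with hc
  have hc0 : 0 < c := by
    have : (0 : ℝ) < k.centralBinom := by exact_mod_cast Nat.centralBinom_pos k
    positivity
  have hgd : ∀ x, HasDerivAt g (c * (1 - x ^ 2 / n) ^ k) x := by
    intro x
    have h1 : HasDerivAt (fun y : ℝ => 1 / 2 + y / (2 * √n)) (1 / (2 * √n)) x :=
      ((hasDerivAt_id' x).div_const _).const_add _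
    refine ((hasDerivAt_medianBeta k _).comp x h1).congr_deriv ?_
    have : (1 / 2 + x / (2 * √n)) * (1 - (1 / 2 + x / (2 * √n))) = 1 / 4 * (1 - x ^ 2 / n) := by
      have : x ^ 2 / n = (x / √n) ^ 2 := by rw [div_pow, hs]
      rw [this]; field_simp; ring
    rw [this, mul_pow, hc]
    ring
  -- The factor `1 + 3/(4n)` is pulled out because `(1 + 3/(4n))(1 - x⁴/(4n))` is `1 + (3 -
  -- x⁴)/(4n)` minus `3x⁴/(16n²)`, which is negligible.
  set c' : ℝ := (√(2 * Real.pi))⁻¹ * (1 + 3 / (4 * n)) with hc'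
  have hpi1 : (√(2 * Real.pi))⁻¹ ≤ 1 := by
    refine inv_le_one_of_one_le₀ ?_
    rw [Real.one_le_sqrt]
    linarith [Real.pi_gt_three]
  have h34 : 3 / (4 * n) ≤ 1 := by rw [div_le_one (by positivity)]; linarith
  have h34' : 0 ≤ 3 / (4 * n) := by positivity
  have hc'2 : c' ≤ 2 := by
    calc c' ≤ 1 * (1 + 1) := by rw [hc']; gcongr
      _ = 2 := by norm_num
  have hc'0 : 0 < c' := by positivity
  set ρ : ℝ := c' / c with hρ
  set D : ℝ → ℝ := fun y => uniformExpansion n y - ρ * g y with hD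
  have hDd : ∀ x, HasDerivAt D
      (stdPhi x * (1 + (3 - x ^ 4) / (4 * n)) - ρ * (c * (1 - x ^ 2 / n) ^ k)) x := fun x =>
    (hasDerivAt_uniformExpansion n x).sub ((hgd x).const_mul ρ)
  have hDb : ∀ x, 0 ≤ x → x ≤ √n → |stdPhi x * (1 + (3 - x ^ 4) / (4 * n))
      - ρ * (c * (1 - x ^ 2 / n) ^ k)| ≤ A / n ^ 2 * Real.exp (-x) := by
    intro x hx0 hxb
    have hx2 : x ^ 2 ≤ n := by
      rw [← hs]; exact pow_le_pow_left₀ hx0 hxb 2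
    have h1 := H₁ k hk x hx0 hx2
    rw [← hn] at h1
    have h2 := H4 x hx0
    rw [show (1 / 2 * x ^ 2) = x ^ 2 / 2 by ring] at h2
    have e : stdPhi x * (1 + (3 - x ^ 4) / (4 * n)) - ρ * (c * (1 - x ^ 2 / n) ^ k) =
        3 * x ^ 4 / (16 * n ^ 2) * stdPhi x - c' * ((1 - x ^ 2 / n) ^ k
          - Real.exp (-(x ^ 2 / 2)) * (1 - x ^ 4 / (4 * n))) := by
      rw [hρ, stdPhi_eq, hc']
      field_simp
      ring
    rw [e]
    have e1 : |3 * x ^ 4 / (16 * n ^ 2) * stdPhi x| ≤ C4 * Real.exp (-x) / n ^ 2 := by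
      rw [abs_of_nonneg (mul_nonneg (by positivity) (stdPhi_nonneg x))]
      calc 3 * x ^ 4 / (16 * n ^ 2) * stdPhi x
          ≤ 3 * x ^ 4 / (16 * n ^ 2) * Real.exp (-(x ^ 2 / 2)) := by
            gcongr; exact stdPhi_le_exp x
        _ = (3 / 16) * (x ^ 4 * Real.exp (-(x ^ 2 / 2))) / n ^ 2 := by field_simp
        _ ≤ 1 * (C4 * Real.exp (-x)) / n ^ 2 := by gcongr; norm_num
        _ = _ := by ring
    have e2 : |c' * ((1 - x ^ 2 / n) ^ k - Real.exp (-(x ^ 2 / 2)) * (1 - x ^ 4 / (4 * n)))| ≤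
        2 * (C₁ * Real.exp (-x) / n ^ 2) := by
      rw [abs_mul, abs_of_pos hc'0]
      gcongr
    calc _ ≤ _ := abs_sub _ _
      _ ≤ _ := add_le_add e1 e2
      _ = _ := by simp only [A]; ring
  have hDy : ∀ y, 0 ≤ y → y ≤ √n → |D y - D 0| ≤ A / n ^ 2 := fun y hy hyb =>
    abs_sub_le_of_abs_deriv_le_exp hDd (by positivity) hDb hy hyb
  have hg0 : g 0 = 1 / 2 := by
    simp only [hg, zero_div, add_zero, medianBeta_half]
  have hg1 : g √n = 1 := by
    rw [hg]; simp only
    rw [show (1 : ℝ) / 2 + √n / (2 * √n) = 1 by field_simp; norm_num, medianBeta_one]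
  have hu0 : uniformExpansion n 0 = 1 / 2 := by simp [uniformExpansion, stdNormalCDF_zero]
  -- At `y = √n` the Gaussian tail beats every power of `n`.
  have hu1 : |uniformExpansion n √n - 1| ≤ E / n ^ 2 := by
    have f4 := HE4 √n hs0.le
    have f5 := HE5 √n hs0.le
    have f3 := HE3 √n hs0.le
    have q4 : √n ^ 4 = n ^ 2 := by rw [show √n ^ 4 = (√n ^ 2) ^ 2 by ring, hs]
    set ex := Real.exp (-(1 / 2 * √n ^ 2)) with hex
    have t1 : 1 - stdNormalCDF √n ≤ ex := by
      have := one_sub_stdNormalCDF_le hs1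
      rwa [show √n ^ 2 / 2 = 1 / 2 * √n ^ 2 by ring] at this
    have t2 : stdPhi √n ≤ ex := by
      have := stdPhi_le_exp √n
      rwa [show √n ^ 2 / 2 = 1 / 2 * √n ^ 2 by ring] at this
    have t3 := stdNormalCDF_le_one √n
    have t4 := stdPhi_nonneg √n
    have t5 : |stdNormalCDF √n - 1| ≤ E4 / n ^ 2 := by
      rw [abs_sub_comm, abs_of_nonneg (by linarith), le_div_iff₀ (by positivity), ← q4]
      nlinarith [pow_pos hs0 4]
    have t6 : |(√n ^ 3 + 3 * √n) * stdPhi √n / (4 * n)| ≤ (E5 + E3) / n ^ 2 := by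
      rw [abs_of_nonneg (by positivity), le_div_iff₀ (by positivity)]
      have e : (√n ^ 3 + 3 * √n) * stdPhi √n / (4 * n) * n ^ 2 =
          (1 / 4) * (√n ^ 5 * stdPhi √n) + (3 / 4) * (√n ^ 3 * stdPhi √n) := by
        have : (√n ^ 3 + 3 * √n) * stdPhi √n / (4 * n) * n ^ 2
          = (√n ^ 3 + 3 * √n) * stdPhi √n / 4 * n := by field_simp
        rw [this]
        nth_rw 4 [← hs]
        ring
      rw [e]
      have r5 : √n ^ 5 * stdPhi √n ≤ √n ^ 5 * ex := by gcongr
      have r3 : √n ^ 3 * stdPhi √n ≤ √n ^ 3 * ex := by gcongr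
      linarith
    calc |uniformExpansion n √n - 1|
        = |(stdNormalCDF √n - 1) + (√n ^ 3 + 3 * √n) * stdPhi √n / (4 * n)| := by
          rw [uniformExpansion]; ring_nf
      _ ≤ _ := abs_add_le _ _
      _ ≤ _ := add_le_add t5 t6
      _ = _ := by simp only [E]; ring
  have hD0 : D 0 = 1 / 2 - ρ / 2 := by simp only [hD, hu0, hg0]; ring
  -- `g` equals `1/2` at `0` and `1` at `√n`, so the bound on `D √n - D 0` is one on `(1 - ρ)/2`, up
  -- to the tail just estimated.
  have hρ1 : |1 - ρ| ≤ 2 * (A + E) / n ^ 2 := by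
    have h1 := hDy √n hs0.le le_rfl
    rw [hD0] at h1
    simp only [hD, hg1] at h1
    have e : 1 - ρ = 2 * ((uniformExpansion n √n - ρ * 1 - (1 / 2 - ρ / 2))
        - (uniformExpansion n √n - 1)) := by ring
    rw [e, abs_mul, abs_two]
    calc _ ≤ 2 * (_ + _) := by gcongr; exact abs_sub _ _
      _ ≤ 2 * (A / n ^ 2 + E / n ^ 2) := by gcongr
      _ = _ := by ring
  have hgy : 0 ≤ g y ∧ g y ≤ 1 := by
    have i0 : 0 ≤ y / (2 * √n) := by positivity
    have i1 : y / (2 * √n) ≤ 1 / 2 := by rw [div_le_iff₀ (by positivity)]; linarith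
    have m0 : (0 : ℝ) ∈ Set.Icc (0 : ℝ) 1 := by simp
    have m1 : (1 : ℝ) ∈ Set.Icc (0 : ℝ) 1 := by simp
    have my : 1 / 2 + y / (2 * √n) ∈ Set.Icc (0 : ℝ) 1 := ⟨by linarith, by linarith⟩
    have j0 := medianBeta_mono k m0 my my.1
    have j1 := medianBeta_mono k my m1 my.2
    rw [medianBeta_zero] at j0
    rw [medianBeta_one] at j1
    exact ⟨j0, j1⟩
  have e : g y - uniformExpansion n y = -(D y - D 0) + (1 - ρ) * (g y - 1 / 2) := by
    rw [hD0]; simp only [hD]; ring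
  change |g y - uniformExpansion n y| ≤ _
  rw [e]
  have h5 : |(1 - ρ) * (g y - 1 / 2)| ≤ 2 * (A + E) / n ^ 2 * 1 := by
    rw [abs_mul]
    gcongr
    rw [abs_le]; constructor <;> linarith [hgy.1, hgy.2]
  calc _ ≤ |-(D y - D 0)| + |(1 - ρ) * (g y - 1 / 2)| := abs_add_le _ _
    _ ≤ A / n ^ 2 + 2 * (A + E) / n ^ 2 * 1 := by
        rw [abs_neg]; exact add_le_add (hDy y hy0 hyb) h5
    _ ≤ _ := by
        have : A / n ^ 2 + 2 * (A + E) / n ^ 2 * 1 = (A + 2 * (A + E)) / n ^ 2 := by ring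
        rw [this]
        have : 0 < A + E := by positivity
        gcongr
        norm_num

/-! ### Order statistics -/

lemma orderStat_le_iff {m : ℕ} (v : Fin m → ℝ) {k : ℕ} (h1 : 1 ≤ k) (hm : k ≤ m) (y : ℝ) :
    orderStat v k ≤ y ↔ k ≤ (Finset.univ.filter fun i => v i ≤ y).card := by
  rw [orderStat, dif_pos ⟨h1, hm⟩]
  have h := Tuple.lt_card_le_iff_apply_le_of_monotone (j := (⟨k - 1, by omega⟩ : Fin m))
    (f := v ∘ Tuple.sort v) (a := y) (Tuple.monotone_sort v)
  have hc : (Finset.univ.filter fun i => (v ∘ Tuple.sort v) i ≤ y).card =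
      (Finset.univ.filter fun i => v i ≤ y).card :=
    Finset.card_equiv (Tuple.sort v) (by simp)
  simp only [Function.comp_apply] at h hc
  rw [← h, ← hc]
  omega

/-- The observations not exceeding the `k`-th order statistic number at least `k` and all belong to
`S`, so they are exactly `S`. -/
lemma orderStat_eq_sup' {m k : ℕ} (v : Fin m → ℝ) (t : ℝ) {S : Finset (Fin m)}
    (hS : (Finset.univ.filter fun i => v i ≤ t) = S) (hk : S.card = k) (hne : S.Nonempty) :
    orderStat v k = S.sup' hne v := by
  have h1 : 1 ≤ k := hk ▸ hne.card_pos
  have hm : k ≤ m := by simpa [hk] using S.card_le_univ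
  apply le_antisymm
  · rw [orderStat_le_iff v h1 hm, ← hk]
    refine Finset.card_le_card fun i hi => ?_
    exact Finset.mem_filter.2 ⟨Finset.mem_univ _, Finset.le_sup' v hi⟩
  · set z := orderStat v k with hz
    have hc : k ≤ (Finset.univ.filter fun i => v i ≤ z).card := (orderStat_le_iff v h1 hm z).1 le_rfl
    have hzt : z ≤ t := (orderStat_le_iff v h1 hm t).2 (by rw [hS, hk])
    have hsub : (Finset.univ.filter fun i => v i ≤ z) ⊆ S := by
      rw [← hS]
      exact Finset.monotone_filter_right _ fun i _ h => h.trans hzt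
    have heq := Finset.eq_of_subset_of_card_le hsub (by omega)
    refine Finset.sup'_le hne v fun i hi => ?_
    rw [← heq] at hi
    simpa using hi

lemma orderStat_succ_eq_inf' {m k : ℕ} (v : Fin m → ℝ) (t : ℝ) {S : Finset (Fin m)}
    (hS : (Finset.univ.filter fun i => v i ≤ t) = S) (hk : S.card = k) (hne : Sᶜ.Nonempty) :
    orderStat v (k + 1) = Sᶜ.inf' hne v := by
  have hm : k + 1 ≤ m := by
    have := hne.card_pos
    rw [Finset.card_compl, Fintype.card_fin] at this
    omega
  have hmem : ∀ i, i ∈ S ↔ v i ≤ t := fun i => by rw [← hS]; simp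
  apply le_antisymm
  · rw [orderStat_le_iff v (by omega) hm]
    obtain ⟨i₀, hi₀, he⟩ := Finset.exists_mem_eq_inf' hne v
    have h0 : i₀ ∉ S := by simpa using hi₀
    have hti : t < v i₀ := by
      by_contra h
      exact h0 ((hmem _).2 (not_lt.1 h))
    rw [he, ← hk, ← Finset.card_insert_of_notMem h0]
    refine Finset.card_le_card fun i hi => ?_
    rw [Finset.mem_insert] at hi
    rcases hi with rfl | hi
    · simp
    · simpa using ((hmem _).1 hi).trans hti.le
  · set z := orderStat v (k + 1) with hz
    have hc : k + 1 ≤ (Finset.univ.filter fun i => v i ≤ z).card :=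
      (orderStat_le_iff v (by omega) hm z).1 le_rfl
    obtain ⟨i, hi, hiS⟩ := Finset.exists_mem_notMem_of_card_lt_card (s := S)
      (lt_of_lt_of_le (by omega) hc)
    exact (Finset.inf'_le v (by simpa using hiS)).trans (by simpa using hi)

/-! ### The number of observations below a level -/

section Sample

variable {Ω : Type*} [MeasurableSpace Ω] {P : Measure Ω} [IsProbabilityMeasure P] {m : ℕ}
  {X : Fin m → Ω → ℝ} {μ : Measure ℝ} [IsProbabilityMeasure μ]

/-- The indices of the observations that are at most `t`. -/
noncomputable def lowerIndices {Ω : Type*} {m : ℕ} (X : Fin m → Ω → ℝ) (t : ℝ) (ω : Ω) :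
    Finset (Fin m) := Finset.univ.filter fun i => X i ω ≤ t

lemma lowerIndices_eq_iff {Ω : Type*} (X : Fin m → Ω → ℝ) (t : ℝ) (S : Finset (Fin m)) (ω : Ω) :
    lowerIndices X t ω = S ↔ ∀ i, X i ω ∈ if i ∈ S then Set.Iic t else Set.Ioi t := by
  rw [lowerIndices, Finset.ext_iff]
  refine forall_congr' fun i => ?_
  by_cases h : i ∈ S <;> simp [h]

lemma measurableSet_lowerIndices_eq (hX : ∀ i, Measurable (X i)) (t : ℝ) (S : Finset (Fin m)) :
    MeasurableSet {ω | lowerIndices X t ω = S} := by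
  simp only [lowerIndices_eq_iff, Set.ofPred_forall]
  refine MeasurableSet.iInter fun i => hX i ?_
  split_ifs
  · exact measurableSet_Iic
  · exact measurableSet_Ioi

lemma measureReal_lowerIndices_mem (hX : ∀ i, Measurable (X i)) (t : ℝ)
    (T : Finset (Finset (Fin m))) :
    P.real {ω | lowerIndices X t ω ∈ T} = ∑ S ∈ T, P.real {ω | lowerIndices X t ω = S} := by
  have : {ω | lowerIndices X t ω ∈ T} = ⋃ S ∈ T, {ω | lowerIndices X t ω = S} := by
    ext ω; simp
  rw [this, measureReal_biUnion_finset]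
  · intro S _ S' _ hne
    rw [Function.onFun, Set.disjoint_left]
    intro ω h h'
    exact hne (h.symm.trans h')
  · exact fun S _ => measurableSet_lowerIndices_eq hX t S

lemma measureReal_forall_mem_eq_prod {Ω : Type*} [MeasurableSpace Ω] {P : Measure Ω}
    {X : Fin m → Ω → ℝ} {μ : Measure ℝ} (hX : ∀ i, Measurable (X i)) (hi : iIndepFun X P)
    (hμ : ∀ i, P.map (X i) = μ) (I : Finset (Fin m)) {s : Fin m → Set ℝ}
    (hs : ∀ i, MeasurableSet (s i)) :
    P.real {ω | ∀ i ∈ I, X i ω ∈ s i} = ∏ i ∈ I, μ.real (s i) := by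
  have h := hi.measure_inter_preimage_eq_mul I (sets := s) (fun i _ => hs i)
  have e : {ω | ∀ i ∈ I, X i ω ∈ s i} = ⋂ i ∈ I, X i ⁻¹' s i := by ext; simp
  rw [measureReal_def, e, h, ENNReal.toReal_prod]
  refine Finset.prod_congr rfl fun i _ => ?_
  rw [measureReal_def, ← hμ i, Measure.map_apply (hX i) (hs i)]

lemma measureReal_Ioi (t : ℝ) : μ.real (Set.Ioi t) = 1 - μ.real (Set.Iic t) := by
  rw [← Set.compl_Iic, probReal_compl_eq_one_sub measurableSet_Iic]

lemma measureReal_lowerIndices_eq (hX : ∀ i, Measurable (X i)) (hi : iIndepFun X P)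
    (hμ : ∀ i, P.map (X i) = μ) (t : ℝ) (S : Finset (Fin m)) :
    P.real {ω | lowerIndices X t ω = S} =
      μ.real (Set.Iic t) ^ S.card * (1 - μ.real (Set.Iic t)) ^ (m - S.card) := by
  have h := measureReal_forall_mem_eq_prod hX hi hμ Finset.univ
    (s := fun i => if i ∈ S then Set.Iic t else Set.Ioi t)
    (fun i => by split_ifs; exacts [measurableSet_Iic, measurableSet_Ioi])
  simp only [Finset.mem_univ, true_imp_iff, ← lowerIndices_eq_iff] at h
  rw [h]
  have : ∀ i, μ.real (if i ∈ S then Set.Iic t else Set.Ioi t) =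
      if i ∈ S then μ.real (Set.Iic t) else 1 - μ.real (Set.Iic t) := fun i => by
    split_ifs
    · rfl
    · exact measureReal_Ioi t
  simp only [this]
  rw [Finset.prod_ite]
  simp only [Finset.prod_const]
  have e1 : (Finset.univ.filter fun i => i ∈ S) = S := by ext; simp
  have e2 : (Finset.univ.filter fun i => i ∉ S) = Sᶜ := by ext; simp
  rw [e1, e2, Finset.card_compl, Fintype.card_fin]

lemma measureReal_le_card_lowerIndices (hX : ∀ i, Measurable (X i)) (hi : iIndepFun X P)
    (hμ : ∀ i, P.map (X i) = μ) (t : ℝ) (r : ℕ) :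
    P.real {ω | r ≤ (lowerIndices X t ω).card} = binomTail m r (μ.real (Set.Iic t)) := by
  have e : {ω | r ≤ (lowerIndices X t ω).card} =
      {ω | lowerIndices X t ω ∈ Finset.univ.filter fun S : Finset (Fin m) => r ≤ S.card} := by
    ext; simp
  rw [e, measureReal_lowerIndices_mem hX]
  simp only [measureReal_lowerIndices_eq hX hi hμ]
  rw [Finset.sum_filter, ← Finset.powerset_univ,
    Finset.sum_powerset_apply_card (fun j => if r ≤ j then
      μ.real (Set.Iic t) ^ j * (1 - μ.real (Set.Iic t)) ^ (m - j) else 0),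
    Finset.card_univ, Fintype.card_fin, binomTail]
  simp only [smul_ite, smul_zero, nsmul_eq_mul]
  rw [← Finset.sum_filter]
  refine Finset.sum_congr ?_ fun j _ => by ring
  ext j; simp; omega

/-! ### The median of an odd number of observations -/

lemma measureReal_sampleMedian_le_of_odd {k : ℕ} {X : Fin (2 * k + 1) → Ω → ℝ}
    (hX : ∀ i, Measurable (X i)) (hi : iIndepFun X P) (hμ : ∀ i, P.map (X i) = μ) (t : ℝ) :
    P.real {ω | sampleMedian (fun i => X i ω) ≤ t} = medianBeta k (μ.real (Set.Iic t)) := by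
  rw [← binomTail_odd_eq_medianBeta, ← measureReal_le_card_lowerIndices hX hi hμ]
  congr 1
  ext ω
  have h : ¬ Even (2 * k + 1) := by simp
  rw [Set.mem_ofPred_eq, sampleMedian, if_neg h, show (2 * k + 1 + 1) / 2 = k + 1 by omega,
    orderStat_le_iff _ (by omega) (by omega)]
  rfl

end Sample

/-! ### The probability integral transform of a maximum -/

section Maximum

variable {μ ν : Measure ℝ} [IsProbabilityMeasure μ] [IsProbabilityMeasure ν]

lemma measureReal_Iic_mono : Monotone fun x : ℝ => μ.real (Set.Iic x) := fun _ _ h =>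
  measureReal_mono (Set.Iic_subset_Iic.2 h)

lemma exists_measureReal_Iic_eq (hF : Continuous fun x : ℝ => μ.real (Set.Iic x)) {t a : ℝ}
    (h0 : 0 < a) (ha : a ≤ μ.real (Set.Iic t)) : ∃ y, μ.real (Set.Iic y) = a := by
  have hlim : Tendsto (fun x : ℝ => μ.real (Set.Iic x)) atBot (𝓝 0) := by
    simpa only [← cdf_eq_real] using tendsto_cdf_atBot μ
  obtain ⟨y₀, hy₀⟩ := (hlim.eventually (gt_mem_nhds h0)).exists
  exact mem_range_of_exists_le_of_exists_ge hF ⟨y₀, hy₀.le⟩ ⟨t, ha⟩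

/-- The function `F` need not be injective, so `{F ≤ a}` may reach beyond a point where `F = a`. The
upper bound therefore uses points where `F = a'` for `a' > a` and lets `a'` decrease to `a`. -/
lemma measureReal_inter_cdf_le {k : ℕ} (hk : 1 ≤ k)
    (hF : Continuous fun x : ℝ => μ.real (Set.Iic x))
    (hν : ∀ y, ν.real (Set.Iic y) = μ.real (Set.Iic y) ^ k) {t a : ℝ} (h0 : 0 ≤ a)
    (ha : a ≤ μ.real (Set.Iic t)) :
    ν.real ({y | μ.real (Set.Iic y) ≤ a} ∩ Set.Iic t) = a ^ k := by
  rcases ha.eq_or_lt with rfl | haq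
  · rw [Set.inter_eq_right.2, hν]
    exact fun y hy => measureReal_Iic_mono hy
  apply le_antisymm
  · have hc : Tendsto (fun x : ℝ => x ^ k) (𝓝[>] a) (𝓝 (a ^ k)) :=
      ((continuous_pow k).tendsto a).mono_left nhdsWithin_le_nhds
    refine ge_of_tendsto hc ?_
    filter_upwards [Ioo_mem_nhdsGT haq] with a' ha'
    obtain ⟨y', hy'⟩ := exists_measureReal_Iic_eq hF (h0.trans_lt ha'.1) ha'.2.le
    rw [← hy', ← hν]
    refine measureReal_mono fun y hy => ?_
    by_contra hlt
    have : μ.real (Set.Iic y') ≤ μ.real (Set.Iic y) := measureReal_Iic_mono (not_le.1 hlt).le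
    have h2 : μ.real (Set.Iic y) ≤ a := hy.1
    linarith [ha'.1]
  · rcases h0.eq_or_lt with rfl | h0
    · rw [zero_pow (by omega)]
      exact measureReal_nonneg
    obtain ⟨y, hy⟩ := exists_measureReal_Iic_eq hF h0 haq.le
    nth_rewrite 1 [← hy]
    rw [← hν]
    refine measureReal_mono fun z hz => ⟨(measureReal_Iic_mono hz).trans_eq hy, ?_⟩
    have hz' : z ≤ y := hz
    by_contra hlt
    have : μ.real (Set.Iic t) ≤ μ.real (Set.Iic y) :=
      measureReal_Iic_mono ((not_le.1 hlt).le.trans hz')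
    linarith

lemma lintegral_pow_density {k : ℕ} (hk : 1 ≤ k) {a : ℝ} (ha : 0 ≤ a) :
    ∫⁻ v in Set.Ioc 0 a, ENNReal.ofReal (k * v ^ (k - 1)) = ENNReal.ofReal (a ^ k) := by
  have hc : Continuous fun v : ℝ => (k : ℝ) * v ^ (k - 1) := by fun_prop
  have hi : IntegrableOn (fun v : ℝ => (k : ℝ) * v ^ (k - 1)) (Set.Ioc 0 a) :=
    (hc.integrableOn_Icc (a := 0) (b := a)).mono_set Set.Ioc_subset_Icc_self
  rw [← ofReal_integral_eq_lintegral_ofReal hi]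
  · rw [← intervalIntegral.integral_of_le ha, intervalIntegral.integral_const_mul, integral_pow]
    congr 1
    have : ((k - 1 : ℕ) : ℝ) + 1 = k := by exact_mod_cast Nat.sub_add_cancel hk
    rw [this, Nat.sub_add_cancel hk, zero_pow (by omega)]
    have : (k : ℝ) ≠ 0 := by positivity
    field_simp
    ring
  · refine (ae_restrict_iff' measurableSet_Ioc).2 (ae_of_all _ fun v hv => ?_)
    have := hv.1.le
    positivity

/-- A law with distribution function `F^k` is carried by `F` to the law of the maximum of `k`
uniform variables. This turns integrals against `ν` into integrals over `[0, q]`. -/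
lemma map_cdf_restrict_eq_withDensity {k : ℕ} (hk : 1 ≤ k)
    (hF : Continuous fun x : ℝ => μ.real (Set.Iic x))
    (hν : ∀ y, ν.real (Set.Iic y) = μ.real (Set.Iic y) ^ k) (t : ℝ) :
    (ν.restrict (Set.Iic t)).map (fun x => μ.real (Set.Iic x)) =
      (volume.restrict (Set.Ioc 0 (μ.real (Set.Iic t)))).withDensity
        (fun v => ENNReal.ofReal (k * v ^ (k - 1))) := by
  have hm : Measurable fun x : ℝ => μ.real (Set.Iic x) := hF.measurable
  set q := μ.real (Set.Iic t) with hq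
  have hq0 : 0 ≤ q := measureReal_nonneg
  refine Measure.ext_of_Iic _ _ fun a => ?_
  rw [Measure.map_apply hm measurableSet_Iic, Measure.restrict_apply (hm measurableSet_Iic),
    withDensity_apply _ measurableSet_Iic, Measure.restrict_restrict measurableSet_Iic]
  rcases lt_or_ge a 0 with ha | ha
  · have e1 : (fun x : ℝ => μ.real (Set.Iic x)) ⁻¹' Set.Iic a ∩ Set.Iic t = ∅ := by
      refine Set.eq_empty_of_forall_notMem fun y hy => ?_
      have h1 : μ.real (Set.Iic y) ≤ a := hy.1
      have h2 : 0 ≤ μ.real (Set.Iic y) := measureReal_nonneg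
      linarith
    have e2 : Set.Iic a ∩ Set.Ioc 0 q = ∅ := by
      refine Set.eq_empty_of_forall_notMem fun y hy => ?_
      have h1 : y ≤ a := hy.1
      linarith [hy.2.1]
    rw [e1, e2]; simp
  · have e1 : (fun x : ℝ => μ.real (Set.Iic x)) ⁻¹' Set.Iic a ∩ Set.Iic t =
        {y | μ.real (Set.Iic y) ≤ min a q} ∩ Set.Iic t := by
      ext y
      simp only [Set.mem_inter_iff, Set.mem_preimage, Set.mem_Iic, Set.mem_ofPred_eq, le_min_iff]
      constructor
      · rintro ⟨h1, h2⟩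
        exact ⟨⟨h1, measureReal_Iic_mono h2⟩, h2⟩
      · rintro ⟨⟨h1, -⟩, h2⟩
        exact ⟨h1, h2⟩
    have e2 : Set.Iic a ∩ Set.Ioc 0 q = Set.Ioc 0 (min a q) := by
      ext y
      simp only [Set.mem_inter_iff, Set.mem_Iic, Set.mem_Ioc, le_min_iff]
      tauto
    rw [e1, e2, lintegral_pow_density hk (le_min ha hq0),
      ← measureReal_inter_cdf_le hk hF hν (t := t) (le_min ha hq0) (min_le_right _ _),
      measureReal_def, ENNReal.ofReal_toReal (measure_ne_top _ _)]

lemma setIntegral_comp_cdf {k : ℕ} (hk : 1 ≤ k)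
    (hF : Continuous fun x : ℝ => μ.real (Set.Iic x))
    (hν : ∀ y, ν.real (Set.Iic y) = μ.real (Set.Iic y) ^ k) (t : ℝ) {g : ℝ → ℝ}
    (hg : Continuous g) :
    ∫ y in Set.Iic t, g (μ.real (Set.Iic y)) ∂ν =
      ∫ v in (0 : ℝ)..μ.real (Set.Iic t), k * v ^ (k - 1) * g v := by
  have hm : Measurable fun x : ℝ => μ.real (Set.Iic x) := hF.measurable
  rw [← integral_map (φ := fun x : ℝ => μ.real (Set.Iic x)) hm.aemeasurable
      hg.aestronglyMeasurable, map_cdf_restrict_eq_withDensity hk hF hν,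
    integral_withDensity_eq_integral_toReal_smul (by fun_prop)
      (ae_of_all _ fun _ => ENNReal.ofReal_lt_top),
    intervalIntegral.integral_of_le measureReal_nonneg]
  refine setIntegral_congr_fun measurableSet_Ioc fun v hv => ?_
  have : 0 ≤ (k : ℝ) * v ^ (k - 1) := by have := hv.1.le; positivity
  simp only [ENNReal.toReal_ofReal this, smul_eq_mul]

lemma integral_pow_mul_sq {k : ℕ} (hk : 1 ≤ k) (q : ℝ) :
    ∫ v in (0 : ℝ)..q, k * v ^ (k - 1) * (q - v) ^ 2 =
      2 * q ^ (k + 2) / ((k + 1) * (k + 2)) := by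
  obtain ⟨l, rfl⟩ : ∃ l, k = l + 1 := ⟨k - 1, by omega⟩
  have h : ∀ v : ℝ, HasDerivAt (fun v : ℝ => q ^ 2 * v ^ (l + 1)
      - 2 * q * (l + 1) / (l + 2) * v ^ (l + 2) + (l + 1) / (l + 3) * v ^ (l + 3))
      (((l + 1 : ℕ) : ℝ) * v ^ (l + 1 - 1) * (q - v) ^ 2) v := by
    intro v
    refine (((hasDerivAt_pow (l + 1) v).const_mul (q ^ 2)).sub
      ((hasDerivAt_pow (l + 2) v).const_mul _) |>.add
      ((hasDerivAt_pow (l + 3) v).const_mul _)).congr_deriv ?_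
    simp only [Nat.add_sub_cancel, show l + 2 - 1 = l + 1 by omega, show l + 3 - 1 = l + 2 by omega]
    push_cast
    field_simp
    ring
  rw [intervalIntegral.integral_eq_sub_of_hasDerivAt (fun v _ => h v)
    (Continuous.intervalIntegrable (by fun_prop) _ _)]
  push_cast
  simp only [ne_eq, Nat.add_eq_zero_iff, one_ne_zero, and_false, not_false_eq_true, zero_pow,
    OfNat.ofNat_ne_zero, mul_zero]
  field_simp
  ring

lemma integral_pow_mul_sub {k : ℕ} (hk : 1 ≤ k) (q : ℝ) :
    ∫ v in (0 : ℝ)..q, k * v ^ (k - 1) * (q - v) = q ^ (k + 1) / (k + 1) := by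
  obtain ⟨l, rfl⟩ : ∃ l, k = l + 1 := ⟨k - 1, by omega⟩
  have h : ∀ v : ℝ, HasDerivAt (fun v : ℝ => q * v ^ (l + 1) - (l + 1) / (l + 2) * v ^ (l + 2))
      (((l + 1 : ℕ) : ℝ) * v ^ (l + 1 - 1) * (q - v)) v := by
    intro v
    refine (((hasDerivAt_pow (l + 1) v).const_mul q).sub
      ((hasDerivAt_pow (l + 2) v).const_mul _)).congr_deriv ?_
    simp only [Nat.add_sub_cancel, show l + 2 - 1 = l + 1 by omega]
    push_cast
    field_simp
    ring
  rw [intervalIntegral.integral_eq_sub_of_hasDerivAt (fun v _ => h v)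
    (Continuous.intervalIntegrable (by fun_prop) _ _)]
  push_cast
  simp only [ne_eq, Nat.add_eq_zero_iff, one_ne_zero, and_false, not_false_eq_true, zero_pow,
    OfNat.ofNat_ne_zero, mul_zero]
  field_simp
  ring

/-- The integrand is the derivative of `(v (v + 1 - 2q))^k`. -/
lemma integral_pow_mul_pow_eq {k : ℕ} (hk : 1 ≤ k) (q : ℝ) :
    ∫ v in (0 : ℝ)..q, k * v ^ (k - 1) * ((v + (1 - 2 * q)) ^ (k - 1) * (2 * v + (1 - 2 * q))) =
      (q * (1 - q)) ^ k := by
  have h : ∀ v : ℝ, HasDerivAt (fun v : ℝ => (v * (v + (1 - 2 * q))) ^ k)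
      (k * v ^ (k - 1) * ((v + (1 - 2 * q)) ^ (k - 1) * (2 * v + (1 - 2 * q)))) v := by
    intro v
    refine (((hasDerivAt_id' v).mul ((hasDerivAt_id' v).add_const (1 - 2 * q))).pow k).congr_deriv ?_
    simp only [Pi.mul_apply, mul_pow]
    ring
  rw [intervalIntegral.integral_eq_sub_of_hasDerivAt (fun v _ => h v)
    (Continuous.intervalIntegrable (by fun_prop) _ _)]
  simp only [zero_mul, zero_pow (by omega : k ≠ 0), sub_zero]
  ring

/-- Since `v + 1 - 2q - (1-q)(2v + 1 - 2q) = (q - v)(1 - 2q)`, the integrand differs from `1 - q`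
times an exact derivative by a term carrying a factor `q - v`, which gains `1/(k+1)` on integration.
The assumption `q ≤ 2/3` ensures `|v + 1 - 2q| ≤ 1 - q`. -/
lemma abs_integral_pow_mul_pow_sub_le {k : ℕ} (hk : 1 ≤ k) {q : ℝ} (h0 : 0 ≤ q) (h1 : q ≤ 2 / 3) :
    |(∫ v in (0 : ℝ)..q, k * v ^ (k - 1) * (v + (1 - 2 * q)) ^ k)
      - (1 - q) * (q * (1 - q)) ^ k| ≤ (1 - q) ^ (k - 1) * (q ^ (k + 1) / (k + 1)) := by
  rw [← integral_pow_mul_pow_eq hk q, ← intervalIntegral.integral_const_mul,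
    ← intervalIntegral.integral_sub (Continuous.intervalIntegrable (by fun_prop) _ _)
      (Continuous.intervalIntegrable (by fun_prop) _ _), ← integral_pow_mul_sub hk q,
    ← intervalIntegral.integral_const_mul, ← Real.norm_eq_abs]
  refine intervalIntegral.norm_integral_le_of_norm_le h0 (ae_of_all _ fun v hv => ?_)
    (Continuous.intervalIntegrable (by fun_prop) _ _)
  have e : (k : ℝ) * v ^ (k - 1) * (v + (1 - 2 * q)) ^ k - (1 - q) *
      (k * v ^ (k - 1) * ((v + (1 - 2 * q)) ^ (k - 1) * (2 * v + (1 - 2 * q)))) =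
      (k * v ^ (k - 1) * (q - v)) * ((v + (1 - 2 * q)) ^ (k - 1) * (1 - 2 * q)) := by
    obtain ⟨l, rfl⟩ : ∃ l, k = l + 1 := ⟨k - 1, by omega⟩
    simp only [Nat.add_sub_cancel, pow_succ]
    ring
  have hv0 : 0 ≤ v := hv.1.le
  have hvq : 0 ≤ q - v := by linarith [hv.2]
  rw [e, Real.norm_eq_abs, abs_mul, abs_of_nonneg (by positivity : 0 ≤ (k : ℝ) * v ^ (k - 1) * (q - v)),
    mul_comm]
  refine mul_le_mul_of_nonneg_right ?_ (by positivity)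
  rw [abs_mul, abs_pow]
  calc _ ≤ (1 - q) ^ (k - 1) * 1 := by
        gcongr
        · exact pow_nonneg (by linarith) _
        · rw [abs_le]; constructor <;> linarith
        · rw [abs_le]; constructor <;> linarith
    _ = _ := mul_one _

lemma pow_mul_pow_le_four_pow {k : ℕ} (hk : 1 ≤ k) {q : ℝ} (h0 : 0 ≤ q) (h1 : q ≤ 1) :
    (1 - q) ^ (k - 1) * q ^ (k - 1) ≤ 4 * (1 / 4) ^ k := by
  obtain ⟨l, rfl⟩ : ∃ l, k = l + 1 := ⟨k - 1, by omega⟩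
  rw [Nat.add_sub_cancel, ← mul_pow, pow_succ]
  have : ((1 - q) * q) ^ l ≤ (1 / 4) ^ l :=
    pow_le_pow_left₀ (mul_nonneg (by linarith) h0) (by nlinarith [sq_nonneg (q - 1 / 2)]) l
  linarith

/-- The probability that the average of the maximum of `k` observations and the minimum of `k`
others exceeds `t` while the maximum is at most `t`, compared with the case of the uniform
distribution. -/
lemma abs_setIntegral_one_sub_cdf_pow_sub_le {k : ℕ} (hk : 1 ≤ k)
    (hF : Continuous fun x : ℝ => μ.real (Set.Iic x))
    (hν : ∀ y, ν.real (Set.Iic y) = μ.real (Set.Iic y) ^ k) {t K : ℝ} (hK : 0 ≤ K)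
    (hq : μ.real (Set.Iic t) ≤ 2 / 3)
    (hsym : ∀ s, 0 ≤ s → |(μ.real (Set.Iic (t + s)) - μ.real (Set.Iic t))
      - (μ.real (Set.Iic t) - μ.real (Set.Iic (t - s)))| ≤
        K * (μ.real (Set.Iic t) - μ.real (Set.Iic (t - s))) ^ 2) :
    |(∫ y in Set.Iic t, (1 - μ.real (Set.Iic (2 * t - y))) ^ k ∂ν)
      - (1 - μ.real (Set.Iic t)) * (μ.real (Set.Iic t) * (1 - μ.real (Set.Iic t))) ^ k| ≤
      8 * (K + 1) / k * (1 / 4) ^ k := by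
  set F : ℝ → ℝ := fun x => μ.real (Set.Iic x) with hFdef
  have hF0 : ∀ x, 0 ≤ F x := fun x => measureReal_nonneg
  have hF1 : ∀ x, F x ≤ 1 := fun x => measureReal_le_one
  have hFm : Monotone F := measureReal_Iic_mono
  set q := F t with hqdef
  change |(∫ y in Set.Iic t, (1 - F (2 * t - y)) ^ k ∂ν) - (1 - q) * (q * (1 - q)) ^ k| ≤ _
  change q ≤ 2 / 3 at hq
  have hq0 : 0 ≤ q := hF0 t
  have hk0 : (0 : ℝ) < k := by exact_mod_cast hk
  have hbd : ∀ {f : ℝ → ℝ}, Continuous f → ∀ C, (∀ y, y ≤ t → |f y| ≤ C) →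
      IntegrableOn f (Set.Iic t) ν := fun hf C h =>
    Measure.integrableOn_of_bounded (measure_ne_top _ _) hf.aestronglyMeasurable
      ((ae_restrict_iff' measurableSet_Iic).2 (ae_of_all _ fun y hy => h y hy))
  have hab : ∀ y, y ≤ t → |F y + (1 - 2 * q)| ≤ 1 - q := fun y hy => by
    have := hFm hy
    have := hF0 y
    rw [abs_le]; constructor <;> linarith
  have i1 : IntegrableOn (fun y => (1 - F (2 * t - y)) ^ k) (Set.Iic t) ν := by
    refine hbd (by fun_prop) 1 fun y _ => ?_
    rw [abs_pow]
    refine pow_le_one₀ (abs_nonneg _) ?_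
    rw [abs_le]; constructor <;> linarith [hF0 (2 * t - y), hF1 (2 * t - y)]
  have i2 : IntegrableOn (fun y => (F y + (1 - 2 * q)) ^ k) (Set.Iic t) ν := by
    refine hbd (by fun_prop) 1 fun y hy => ?_
    rw [abs_pow]
    exact pow_le_one₀ (abs_nonneg _) ((hab y hy).trans (by linarith))
  have i3 : IntegrableOn (fun y => k * K * (1 - q) ^ (k - 1) * (q - F y) ^ 2) (Set.Iic t) ν := by
    refine hbd (by fun_prop) (k * K * (1 - q) ^ (k - 1)) fun y hy => ?_
    have h1 : (0 : ℝ) ≤ 1 - q := by linarith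
    rw [abs_mul, abs_of_nonneg (by positivity), abs_of_nonneg (sq_nonneg _)]
    refine mul_le_of_le_one_right (by positivity) ?_
    have := hFm hy
    have := hF0 y
    have := hF1 t
    exact pow_le_one₀ (by linarith) (by linarith)
  have e2 : ∫ y in Set.Iic t, (F y + (1 - 2 * q)) ^ k ∂ν =
      ∫ v in (0 : ℝ)..q, k * v ^ (k - 1) * (v + (1 - 2 * q)) ^ k :=
    setIntegral_comp_cdf hk hF hν t (g := fun v => (v + (1 - 2 * q)) ^ k) (by fun_prop)
  have e3 : ∫ y in Set.Iic t, k * K * (1 - q) ^ (k - 1) * (q - F y) ^ 2 ∂ν =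
      k * K * (1 - q) ^ (k - 1) * (2 * q ^ (k + 2) / ((k + 1) * (k + 2))) := by
    rw [integral_const_mul, ← integral_pow_mul_sq hk q]
    congr 1
    exact setIntegral_comp_cdf hk hF hν t (g := fun v => (q - v) ^ 2) (by fun_prop)
  -- Reflection in `t` replaces `1 - F(2t - y)` by `F y + 1 - 2q` at the cost `K (q - F y)²`. Both
  -- bases are at most `1 - q` in absolute value, so taking `k`-th powers costs `k (1-q)^(k-1)`
  -- more.
  have hpt : ∀ y ∈ Set.Iic t, ‖(1 - F (2 * t - y)) ^ k - (F y + (1 - 2 * q)) ^ k‖ ≤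
      k * K * (1 - q) ^ (k - 1) * (q - F y) ^ 2 := by
    intro y hy
    have hy' : y ≤ t := hy
    have hs := hsym (t - y) (by linarith)
    rw [show t + (t - y) = 2 * t - y by ring, show t - (t - y) = y by ring] at hs
    change |(F (2 * t - y) - q) - (q - F y)| ≤ K * (q - F y) ^ 2 at hs
    have h1 : |(1 - F (2 * t - y)) - (F y + (1 - 2 * q))| ≤ K * (q - F y) ^ 2 := by
      rw [abs_sub_comm]
      convert hs using 2
      ring
    have hw : |1 - F (2 * t - y)| ≤ 1 - q := by
      have := hFm (show t ≤ 2 * t - y by linarith)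
      have := hF1 (2 * t - y)
      rw [abs_le]; constructor <;> linarith
    calc _ ≤ |(1 - F (2 * t - y)) - (F y + (1 - 2 * q))| * k *
          max |1 - F (2 * t - y)| |F y + (1 - 2 * q)| ^ (k - 1) := abs_pow_sub_pow_le _ _ _
      _ ≤ (K * (q - F y) ^ 2) * k * (1 - q) ^ (k - 1) := by
          gcongr
          exact max_le hw (hab y hy')
      _ = _ := by ring
  have hA : |(∫ y in Set.Iic t, (1 - F (2 * t - y)) ^ k ∂ν)
      - ∫ v in (0 : ℝ)..q, k * v ^ (k - 1) * (v + (1 - 2 * q)) ^ k| ≤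
      k * K * (1 - q) ^ (k - 1) * (2 * q ^ (k + 2) / ((k + 1) * (k + 2))) := by
    rw [← e2, ← e3, ← integral_sub i1 i2, ← Real.norm_eq_abs]
    exact norm_integral_le_of_norm_le i3
      ((ae_restrict_iff' measurableSet_Iic).2 (ae_of_all _ hpt))
  have hB := abs_integral_pow_mul_pow_sub_le hk hq0 hq
  have h4 := pow_mul_pow_le_four_pow hk hq0 (by linarith : q ≤ 1)
  -- Both errors contain `G`, which is at most `4 · 4^(-k)`; the spare powers of `q` are bounded by
  -- `1`.
  set G := (1 - q) ^ (k - 1) * q ^ (k - 1) with hG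
  have hG0 : 0 ≤ G := mul_nonneg (pow_nonneg (by linarith) _) (by positivity)
  have hq1 : q ≤ 1 := hF1 t
  have c1 : k * K * (1 - q) ^ (k - 1) * (2 * q ^ (k + 2) / ((k + 1) * (k + 2))) ≤
      2 * K / k * G := by
    have : q ^ (k + 2) = q ^ (k - 1) * q ^ 3 := by rw [← pow_add]; congr 1; omega
    rw [this]
    have e : k * K * (1 - q) ^ (k - 1) * (2 * (q ^ (k - 1) * q ^ 3) / ((k + 1) * (k + 2))) =
        (2 * K * G) * (k / ((k + 1) * (k + 2)) * q ^ 3) := by rw [hG]; ring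
    have e' : 2 * K / k * G = (2 * K * G) * (1 / k) := by ring
    rw [e, e']
    refine mul_le_mul_of_nonneg_left ?_ (by positivity)
    have : q ^ 3 ≤ 1 := pow_le_one₀ hq0 hq1
    calc (k : ℝ) / ((k + 1) * (k + 2)) * q ^ 3 ≤ k / ((k + 1) * (k + 2)) * 1 := by gcongr
      _ ≤ 1 / k := by
        rw [mul_one, div_le_div_iff₀ (by positivity) (by positivity)]
        nlinarith
  have c2 : (1 - q) ^ (k - 1) * (q ^ (k + 1) / (k + 1)) ≤ 1 / k * G := by
    have : q ^ (k + 1) = q ^ (k - 1) * q ^ 2 := by rw [← pow_add]; congr 1; omega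
    rw [this]
    have e : (1 - q) ^ (k - 1) * (q ^ (k - 1) * q ^ 2 / (k + 1)) = (1 / (k + 1) * q ^ 2) * G := by
      rw [hG]; ring
    rw [e]
    refine mul_le_mul_of_nonneg_right ?_ hG0
    have : q ^ 2 ≤ 1 := pow_le_one₀ hq0 hq1
    calc (1 : ℝ) / (k + 1) * q ^ 2 ≤ 1 / (k + 1) * 1 := by gcongr
      _ ≤ 1 / k := by rw [mul_one]; gcongr; linarith
  calc _ ≤ _ := abs_sub_le _ _ _
    _ ≤ 2 * K / k * G + 1 / k * G := add_le_add (hA.trans c1) (hB.trans c2)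
    _ = (2 * K + 1) / k * G := by ring
    _ ≤ (2 * K + 1) / k * (4 * (1 / 4) ^ k) := by gcongr
    _ = (8 * K + 4) / k * (1 / 4) ^ k := by ring
    _ ≤ _ := by gcongr; linarith

end Maximum

/-! ### The median of an even number of observations -/

section EvenSample

variable {Ω : Type*} [MeasurableSpace Ω] {P : Measure Ω} [IsProbabilityMeasure P] {m : ℕ}
  {X : Fin m → Ω → ℝ} {μ : Measure ℝ} [IsProbabilityMeasure μ]

lemma measurable_sup'_apply (hX : ∀ i, Measurable (X i)) {S : Finset (Fin m)} (hne : S.Nonempty) :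
    Measurable fun ω => S.sup' hne fun i => X i ω := by
  have := Finset.measurable_sup' hne (f := X) fun i _ => hX i
  convert this using 1
  funext ω
  rw [Finset.sup'_apply]

lemma measurable_inf'_apply (hX : ∀ i, Measurable (X i)) {S : Finset (Fin m)} (hne : S.Nonempty) :
    Measurable fun ω => S.inf' hne fun i => X i ω := by
  have : Measurable (S.inf' hne X) :=
    Finset.inf'_induction hne X (fun _ h _ h' => h.inf h') fun i _ => hX i
  convert this using 1
  funext ω
  rw [Finset.inf'_apply]

lemma measureReal_sup'_le (hX : ∀ i, Measurable (X i)) (hi : iIndepFun X P)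
    (hμ : ∀ i, P.map (X i) = μ) {S : Finset (Fin m)} (hne : S.Nonempty) (y : ℝ) :
    (P.map fun ω => S.sup' hne fun i => X i ω).real (Set.Iic y) = μ.real (Set.Iic y) ^ S.card := by
  rw [map_measureReal_apply (measurable_sup'_apply hX hne) measurableSet_Iic]
  have h := measureReal_forall_mem_eq_prod hX hi hμ S (s := fun _ => Set.Iic y)
    (fun _ => measurableSet_Iic)
  rw [Finset.prod_const] at h
  rw [← h]
  congr 1
  ext ω
  simp

lemma measureReal_lt_inf' (hX : ∀ i, Measurable (X i)) (hi : iIndepFun X P)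
    (hμ : ∀ i, P.map (X i) = μ) {S : Finset (Fin m)} (hne : S.Nonempty) (y : ℝ) :
    (P.map fun ω => S.inf' hne fun i => X i ω).real (Set.Ioi y) =
      (1 - μ.real (Set.Iic y)) ^ S.card := by
  rw [map_measureReal_apply (measurable_inf'_apply hX hne) measurableSet_Ioi]
  have h := measureReal_forall_mem_eq_prod hX hi hμ S (s := fun _ => Set.Ioi y)
    (fun _ => measurableSet_Ioi)
  rw [Finset.prod_const, measureReal_Ioi] at h
  rw [← h]
  congr 1
  ext ω
  simp

lemma indepFun_sup'_inf' {Ω : Type*} [MeasurableSpace Ω] {P : Measure Ω}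
    {X : Fin m → Ω → ℝ} (hX : ∀ i, Measurable (X i)) (hi : iIndepFun X P) {S : Finset (Fin m)}
    (h1 : S.Nonempty) (h2 : Sᶜ.Nonempty) :
    IndepFun (fun ω => S.sup' h1 fun i => X i ω) (fun ω => Sᶜ.inf' h2 fun i => X i ω) P := by
  have h := hi.indepFun_finset S Sᶜ disjoint_compl_right hX
  have a1 : S.attach.Nonempty := h1.attach
  have a2 : Sᶜ.attach.Nonempty := h2.attach
  have m1 : Measurable fun v : S → ℝ => S.attach.sup' a1 v := by
    have := Finset.measurable_sup' a1 (f := fun (i : S) (v : S → ℝ) => v i)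
      fun i _ => measurable_pi_apply i
    convert this using 1
    funext ω
    rw [Finset.sup'_apply]
  have m2 : Measurable fun v : (Sᶜ : Finset (Fin m)) → ℝ => Sᶜ.attach.inf' a2 v := by
    have : Measurable (Sᶜ.attach.inf' a2 fun (i : (Sᶜ : Finset (Fin m)))
        (v : (Sᶜ : Finset (Fin m)) → ℝ) => v i) :=
      Finset.inf'_induction a2 _ (fun _ h _ h' => h.inf h') fun i _ => measurable_pi_apply i
    convert this using 1
    funext ω
    rw [Finset.inf'_apply]
  convert h.comp m1 m2 using 1
  · funext ω
    apply le_antisymm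
    · refine Finset.sup'_le h1 _ fun i hi => ?_
      exact Finset.le_sup' (fun i : S => X i ω) (Finset.mem_attach S ⟨i, hi⟩)
    · refine Finset.sup'_le a1 _ fun i _ => ?_
      exact Finset.le_sup' (fun i => X i ω) i.2
  · funext ω
    apply le_antisymm
    · refine Finset.le_inf' a2 _ fun i _ => ?_
      exact Finset.inf'_le (fun i => X i ω) i.2
    · refine Finset.le_inf' h2 _ fun i hi => ?_
      exact Finset.inf'_le (fun i : (Sᶜ : Finset (Fin m)) => X i ω)
        (Finset.mem_attach Sᶜ ⟨i, hi⟩)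

lemma measureReal_prod_setOf_lt {ν κ : Measure ℝ} [IsProbabilityMeasure ν]
    [IsProbabilityMeasure κ] {g : ℝ → ℝ} (hg : Measurable g) (hκ : ∀ y, κ.real (Set.Ioi y) = g y)
    (t : ℝ) :
    (ν.prod κ).real {z | z.1 ≤ t ∧ 2 * t - z.1 < z.2} =
      ∫ y in Set.Iic t, g (2 * t - y) ∂ν := by
  have hs : MeasurableSet {z : ℝ × ℝ | z.1 ≤ t ∧ 2 * t - z.1 < z.2} :=
    (measurableSet_le measurable_fst measurable_const).inter
      (measurableSet_lt (measurable_const.sub measurable_fst) measurable_snd)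
  have hgn : ∀ y, 0 ≤ g y := fun y => hκ y ▸ measureReal_nonneg
  have hg1 : ∀ y, g y ≤ 1 := fun y => hκ y ▸ measureReal_le_one
  have hm : Measurable fun y => g (2 * t - y) := hg.comp (measurable_const.sub measurable_id)
  have hi : IntegrableOn (fun y => g (2 * t - y)) (Set.Iic t) ν :=
    Measure.integrableOn_of_bounded (M := 1) (measure_ne_top _ _) hm.aestronglyMeasurable
      (ae_of_all _ fun y => by rw [Real.norm_eq_abs, abs_of_nonneg (hgn _)]; exact hg1 _)
  rw [measureReal_def, Measure.prod_apply hs]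
  have e : ∀ y, κ (Prod.mk y ⁻¹' {z : ℝ × ℝ | z.1 ≤ t ∧ 2 * t - z.1 < z.2}) =
      (Set.Iic t).indicator (fun y => ENNReal.ofReal (g (2 * t - y))) y := by
    intro y
    by_cases hy : y ≤ t
    · rw [Set.indicator_of_mem (by exact hy), ← hκ, measureReal_def,
        ENNReal.ofReal_toReal (measure_ne_top _ _)]
      congr 1
      ext z; simp [hy]
    · rw [Set.indicator_of_notMem (by exact hy)]
      convert measure_empty (μ := κ)
      ext z; simp [hy]
  simp only [e]
  rw [lintegral_indicator measurableSet_Iic,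
    ← ofReal_integral_eq_lintegral_ofReal hi (ae_of_all _ fun y => hgn _),
    ENNReal.toReal_ofReal (integral_nonneg fun y => hgn _)]

/-- If the maximum over `S` is at most `t` and the average exceeds `t`, then the minimum over the
complement automatically exceeds `t`, so `S` is the full set of lower indices. The event thus
involves only two independent variables. -/
lemma lowerIndices_eq_and_lt_sampleMedian_iff {Ω : Type*} {k : ℕ}
    {X : Fin (2 * k) → Ω → ℝ} {t : ℝ} {S : Finset (Fin (2 * k))} (hS : S.card = k)
    (h1 : S.Nonempty) (h2 : Sᶜ.Nonempty) (ω : Ω) :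
    (lowerIndices X t ω = S ∧ t < sampleMedian (fun i => X i ω)) ↔
      (S.sup' h1 (fun i => X i ω) ≤ t ∧
        2 * t - S.sup' h1 (fun i => X i ω) < Sᶜ.inf' h2 (fun i => X i ω)) := by
  have hev : Even (2 * k) := even_two_mul k
  have hmed : lowerIndices X t ω = S → sampleMedian (fun i => X i ω) =
      (S.sup' h1 (fun i => X i ω) + Sᶜ.inf' h2 (fun i => X i ω)) / 2 := by
    intro h
    rw [sampleMedian, if_pos hev, show 2 * k / 2 = k by omega,
      orderStat_eq_sup' (fun i => X i ω) t h hS h1,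
      orderStat_succ_eq_inf' (fun i => X i ω) t h hS h2]
  constructor
  · rintro ⟨h, hlt⟩
    rw [hmed h] at hlt
    refine ⟨Finset.sup'_le h1 _ fun i hi => ?_, by linarith⟩
    rw [← h] at hi
    simpa [lowerIndices] using hi
  · rintro ⟨hY, hZ⟩
    have h : lowerIndices X t ω = S := by
      ext i
      rw [lowerIndices, Finset.mem_filter]
      constructor
      · rintro ⟨-, hi⟩
        by_contra hiS
        have := Finset.inf'_le (fun i => X i ω) (Finset.mem_compl.2 hiS)
        linarith
      · intro hi
        exact ⟨Finset.mem_univ _, (Finset.le_sup' (fun i => X i ω) hi).trans hY⟩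
    refine ⟨h, ?_⟩
    rw [hmed h]
    linarith

lemma exists_measureReal_lowerIndices_eq_and_le {k : ℕ} (hk : 1 ≤ k)
    {X : Fin (2 * k) → Ω → ℝ} (hX : ∀ i, Measurable (X i)) (hi : iIndepFun X P)
    (hμ : ∀ i, P.map (X i) = μ) (t : ℝ) {S : Finset (Fin (2 * k))} (hS : S.card = k) :
    MeasurableSet {ω | lowerIndices X t ω = S ∧ sampleMedian (fun i => X i ω) ≤ t} ∧
    ∃ ν : Measure ℝ, IsProbabilityMeasure ν ∧
      (∀ y, ν.real (Set.Iic y) = μ.real (Set.Iic y) ^ k) ∧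
      P.real {ω | lowerIndices X t ω = S ∧ sampleMedian (fun i => X i ω) ≤ t} =
        (μ.real (Set.Iic t) * (1 - μ.real (Set.Iic t))) ^ k
          - ∫ y in Set.Iic t, (1 - μ.real (Set.Iic (2 * t - y))) ^ k ∂ν := by
  have h1 : S.Nonempty := Finset.card_pos.1 (by omega)
  have hSc : Sᶜ.card = k := by rw [Finset.card_compl, Fintype.card_fin]; omega
  have h2 : Sᶜ.Nonempty := Finset.card_pos.1 (by omega)
  have hYm := measurable_sup'_apply hX h1
  have hZm := measurable_inf'_apply hX h2
  set Y : Ω → ℝ := fun ω => S.sup' h1 fun i => X i ω with hY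
  set Z : Ω → ℝ := fun ω => Sᶜ.inf' h2 fun i => X i ω with hZ
  have hprod := (indepFun_iff_map_prod_eq_prod_map_map hYm.aemeasurable hZm.aemeasurable).1
    (indepFun_sup'_inf' hX hi h1 h2)
  have hs : MeasurableSet {z : ℝ × ℝ | z.1 ≤ t ∧ 2 * t - z.1 < z.2} :=
    (measurableSet_le measurable_fst measurable_const).inter
      (measurableSet_lt (measurable_const.sub measurable_fst) measurable_snd)
  have hset : {ω | lowerIndices X t ω = S ∧ t < sampleMedian (fun i => X i ω)} =
      (fun ω => (Y ω, Z ω)) ⁻¹' {z : ℝ × ℝ | z.1 ≤ t ∧ 2 * t - z.1 < z.2} := by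
    ext ω
    exact lowerIndices_eq_and_lt_sampleMedian_iff hS h1 h2 ω
  have hmeas : MeasurableSet {ω | lowerIndices X t ω = S ∧ t < sampleMedian (fun i => X i ω)} := by
    rw [hset]; exact (hYm.prodMk hZm) hs
  have hdiff : {ω | lowerIndices X t ω = S ∧ sampleMedian (fun i => X i ω) ≤ t} =
      {ω | lowerIndices X t ω = S} \
        {ω | lowerIndices X t ω = S ∧ t < sampleMedian (fun i => X i ω)} := by
    ext ω
    simp only [Set.mem_ofPred_eq, Set.mem_sdiff, not_and, not_lt]
    tauto
  have hPY : IsProbabilityMeasure (P.map Y) := Measure.isProbabilityMeasure_map hYm.aemeasurable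
  have hPZ : IsProbabilityMeasure (P.map Z) := Measure.isProbabilityMeasure_map hZm.aemeasurable
  refine ⟨?_, P.map Y, hPY, fun y => ?_, ?_⟩
  · rw [hdiff]
    exact (measurableSet_lowerIndices_eq hX t S).diff hmeas
  · rw [measureReal_sup'_le hX hi hμ h1, hS]
  · have hg : Measurable fun y : ℝ => (1 - μ.real (Set.Iic y)) ^ k :=
      (measurable_const.sub (measureReal_Iic_mono (μ := μ)).measurable).pow_const k
    have hsub : {ω | lowerIndices X t ω = S ∧ t < sampleMedian (fun i => X i ω)} ⊆
        {ω | lowerIndices X t ω = S} := fun ω h => h.1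
    rw [hdiff, measureReal_sdiff hsub hmeas, measureReal_lowerIndices_eq hX hi hμ, hS,
      show 2 * k - k = k by omega, ← mul_pow, hset,
      ← map_measureReal_apply (hYm.prodMk hZm) hs, hprod,
      measureReal_prod_setOf_lt hg (fun y => by rw [measureReal_lt_inf' hX hi hμ h2, hSc])]

/-- The event splits into `N ≥ k+1` and, for each `S` with `k` elements, the event that `S` is the
lower set and the median is at most `t`. The law `ν` of the maximum over `S` enters only through its
distribution function, whence the form of the hypothesis. -/
lemma abs_measureReal_sampleMedian_le_sub_le {k : ℕ} (hk : 1 ≤ k)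
    {X : Fin (2 * k) → Ω → ℝ} (hX : ∀ i, Measurable (X i)) (hi : iIndepFun X P)
    (hμ : ∀ i, P.map (X i) = μ) {t ε : ℝ}
    (hε : ∀ ν : Measure ℝ, IsProbabilityMeasure ν →
      (∀ y, ν.real (Set.Iic y) = μ.real (Set.Iic y) ^ k) →
      |(∫ y in Set.Iic t, (1 - μ.real (Set.Iic (2 * t - y))) ^ k ∂ν)
        - (1 - μ.real (Set.Iic t)) * (μ.real (Set.Iic t) * (1 - μ.real (Set.Iic t))) ^ k| ≤ ε) :
    |P.real {ω | sampleMedian (fun i => X i ω) ≤ t} - medianBeta k (μ.real (Set.Iic t))| ≤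
      k.centralBinom * ε := by
  set q := μ.real (Set.Iic t) with hq
  set T := Finset.powersetCard k (Finset.univ : Finset (Fin (2 * k))) with hT
  have hTc : ∀ S ∈ T, S.card = k := fun S hS => (Finset.mem_powersetCard.1 hS).2
  have hTcard : T.card = k.centralBinom := by
    rw [hT, Finset.card_powersetCard, Finset.card_univ, Fintype.card_fin,
      Nat.centralBinom_eq_two_mul_choose]
  have hset : {ω | sampleMedian (fun i => X i ω) ≤ t} =
      {ω | k + 1 ≤ (lowerIndices X t ω).card} ∪
        ⋃ S ∈ T, {ω | lowerIndices X t ω = S ∧ sampleMedian (fun i => X i ω) ≤ t} := by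
    ext ω
    have hev : Even (2 * k) := even_two_mul k
    have hmed : sampleMedian (fun i => X i ω) =
      (orderStat (fun i => X i ω) k + orderStat (fun i => X i ω) (k + 1)) / 2 := by
      rw [sampleMedian, if_pos hev, show 2 * k / 2 = k by omega]
    have o1 := orderStat_le_iff (fun i => X i ω) hk (by omega) t
    have o2 := orderStat_le_iff (fun i => X i ω) (k := k + 1) (by omega) (by omega) t
    change _ ↔ _ ≤ (lowerIndices X t ω).card at o1 o2
    simp only [Set.mem_union, Set.mem_iUnion, Set.mem_ofPred_eq, exists_prop]
    constructor
    · intro h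
      by_cases hc : k + 1 ≤ (lowerIndices X t ω).card
      · exact Or.inl hc
      · refine Or.inr ⟨lowerIndices X t ω, ?_, rfl, h⟩
        rw [hT, Finset.mem_powersetCard]
        refine ⟨Finset.subset_univ _, ?_⟩
        by_contra hne
        -- With fewer than `k` observations at most `t`, both middle order statistics would exceed
        -- `t`, and so would their average.
        have n1 : ¬ k ≤ (lowerIndices X t ω).card := by omega
        rw [← o1, not_le] at n1
        rw [← o2, not_le] at hc
        rw [hmed] at h
        linarith
    · rintro (h | ⟨S, -, -, h⟩)
      · rw [hmed]
        have := o2.2 h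
        have := o1.2 (by omega)
        linarith
      · exact h
  have hmeas : ∀ S ∈ T, MeasurableSet
      {ω | lowerIndices X t ω = S ∧ sampleMedian (fun i => X i ω) ≤ t} := fun S hS =>
    (exists_measureReal_lowerIndices_eq_and_le hk hX hi hμ t (hTc S hS)).1
  have hdisj : Disjoint {ω | k + 1 ≤ (lowerIndices X t ω).card}
      (⋃ S ∈ T, {ω | lowerIndices X t ω = S ∧ sampleMedian (fun i => X i ω) ≤ t}) := by
    rw [Set.disjoint_left]
    intro ω h h'
    simp only [Set.mem_iUnion, Set.mem_ofPred_eq, exists_prop] at h h'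
    obtain ⟨S, hS, hl, -⟩ := h'
    rw [hl, hTc S hS] at h
    omega
  rw [hset, measureReal_union hdisj (Finset.measurableSet_biUnion _ hmeas)
      (measure_ne_top _ _) (measure_ne_top _ _),
    measureReal_le_card_lowerIndices hX hi hμ, measureReal_biUnion_finset _ hmeas,
    ← binomTail_even_add_eq_medianBeta hk]
  · have e : ∑ S ∈ T, (q * (q * (1 - q)) ^ k) = k.centralBinom * (q * (q * (1 - q)) ^ k) := by
      rw [Finset.sum_const, hTcard, nsmul_eq_mul]
    rw [← e, add_sub_add_left_eq_sub, ← Finset.sum_sub_distrib]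
    refine (Finset.abs_sum_le_sum_abs _ _).trans ?_
    rw [← hTcard, ← nsmul_eq_mul]
    refine Finset.sum_le_card_nsmul _ _ _ fun S hS => ?_
    obtain ⟨-, ν, hν1, hν2, h⟩ := exists_measureReal_lowerIndices_eq_and_le hk hX hi hμ t (hTc S hS)
    have := hε ν hν1 hν2
    rw [h]
    have e : ∀ I : ℝ, (q * (1 - q)) ^ k - I - q * (q * (1 - q)) ^ k =
        -(I - (1 - q) * (q * (1 - q)) ^ k) := fun I => by ring
    rw [e, abs_neg]
    exact this
  · intro S _ S' _ hne
    rw [Function.onFun, Set.disjoint_left]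
    intro ω h h'
    exact hne (h.1.symm.trans h'.1)

/-- A crude form of `abs_setIntegral_one_sub_cdf_pow_sub_le` valid at all levels. -/
lemma abs_setIntegral_one_sub_cdf_pow_sub_le_pow {ν : Measure ℝ} [IsProbabilityMeasure ν] {k : ℕ}
    (hν : ∀ y, ν.real (Set.Iic y) = μ.real (Set.Iic y) ^ k) (t : ℝ) :
    |(∫ y in Set.Iic t, (1 - μ.real (Set.Iic (2 * t - y))) ^ k ∂ν)
      - (1 - μ.real (Set.Iic t)) * (μ.real (Set.Iic t) * (1 - μ.real (Set.Iic t))) ^ k| ≤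
      (μ.real (Set.Iic t) * (1 - μ.real (Set.Iic t))) ^ k := by
  set q := μ.real (Set.Iic t) with hq
  have hq0 : 0 ≤ q := measureReal_nonneg
  have hq1 : q ≤ 1 := measureReal_le_one
  have hF1 : ∀ x, μ.real (Set.Iic x) ≤ 1 := fun x => measureReal_le_one
  have hn : ∀ y, 0 ≤ (1 - μ.real (Set.Iic (2 * t - y))) ^ k := fun y =>
    pow_nonneg (by linarith [hF1 (2 * t - y)]) k
  have h0 : 0 ≤ ∫ y in Set.Iic t, (1 - μ.real (Set.Iic (2 * t - y))) ^ k ∂ν :=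
    integral_nonneg hn
  have h1 : ∫ y in Set.Iic t, (1 - μ.real (Set.Iic (2 * t - y))) ^ k ∂ν ≤ (q * (1 - q)) ^ k := by
    have := norm_setIntegral_le_of_norm_le_const (μ := ν) (s := Set.Iic t) (C := (1 - q) ^ k)
      (f := fun y => (1 - μ.real (Set.Iic (2 * t - y))) ^ k) (measure_lt_top _ _) fun y hy => by
        rw [Real.norm_eq_abs, abs_of_nonneg (hn y)]
        have hy' : y ≤ t := hy
        have hm : q ≤ μ.real (Set.Iic (2 * t - y)) := measureReal_Iic_mono (by linarith)
        exact pow_le_pow_left₀ (by linarith [hF1 (2 * t - y)]) (by linarith) k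
    rw [hν, Real.norm_eq_abs, abs_of_nonneg h0] at this
    rw [mul_pow]
    linarith
  have h2 : 0 ≤ (q * (1 - q)) ^ k := pow_nonneg (mul_nonneg hq0 (by linarith)) k
  have h3 : (1 - q) * (q * (1 - q)) ^ k ≤ (q * (1 - q)) ^ k :=
    mul_le_of_le_one_left h2 (by linarith)
  have h4 : 0 ≤ (1 - q) * (q * (1 - q)) ^ k := mul_nonneg (by linarith) h2
  rw [abs_le]
  constructor <;> linarith

end EvenSample

/-! ### The distribution function near its centre -/

/-- The mean value inequality on `[ε, x]`, with `ε → 0+`: only one-sided information at `0` is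
available, since `p` may have a kink there. Repeated use descends from the bound on the third
derivative to the Taylor expansion of `p`. -/
lemma abs_sub_le_of_tendsto_zero {g g' : ℝ → ℝ} {ℓ K x : ℝ} (hx : 0 < x)
    (hg : ∀ y, 0 < y → y ≤ x → HasDerivAt g (g' y) y) (hl : Tendsto g (𝓝[>] 0) (𝓝 ℓ))
    (hK : ∀ y, 0 < y → y ≤ x → |g' y| ≤ K) : |g x - ℓ| ≤ K * x := by
  have hK0 : 0 ≤ K := (abs_nonneg _).trans (hK x hx le_rfl)
  refine le_of_tendsto ((tendsto_const_nhds.sub hl).abs) ?_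
  filter_upwards [Ioo_mem_nhdsGT hx] with ε hε
  have h := Convex.norm_image_sub_le_of_norm_hasDerivWithin_le (f := g) (f' := g') (C := K)
    (s := Set.Icc ε x) (x := ε) (y := x)
    (fun y hy => (hg y (hε.1.trans_le hy.1) hy.2).hasDerivWithinAt)
    (fun y hy => hK y (hε.1.trans_le hy.1) hy.2) (convex_Icc _ _) ⟨le_rfl, hε.2.le⟩
    ⟨hε.2.le, le_rfl⟩
  rw [Real.norm_eq_abs, Real.norm_eq_abs, abs_of_pos (by linarith [hε.2] : 0 < x - ε)] at h
  exact h.trans (mul_le_mul_of_nonneg_left (by linarith [hε.1]) hK0)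

namespace AssumptionA

variable {p : ℝ → ℝ} {x₀ : ℝ}

lemma hasDerivAt_iteratedDeriv (hp : AssumptionA p x₀) {k : ℕ} (hk : k < 3) {x : ℝ} (h0 : 0 < x)
    (h1 : x < x₀) : HasDerivAt (iteratedDeriv k p) (iteratedDeriv (k + 1) p x) x := by
  have h := hp.contDiffOn.differentiableOn_iteratedDerivWithin (m := k) (by exact_mod_cast hk)
    isOpen_Ioo.uniqueDiffOn
  rw [iteratedDeriv_succ]
  exact ((h.congr fun y hy => (iteratedDerivWithin_of_isOpen isOpen_Ioo hy).symm).differentiableAt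
    (Ioo_mem_nhds h0 h1)).hasDerivAt

lemma integrable (hp : AssumptionA p x₀) : Integrable p :=
  ⟨hp.measurable.aestronglyMeasurable, by
    rw [hasFiniteIntegral_iff_ofReal (ae_of_all _ hp.nonneg), hp.lintegral_eq_one]
    exact ENNReal.one_lt_top⟩

lemma integral_eq_one (hp : AssumptionA p x₀) : ∫ x, p x = 1 := by
  rw [integral_eq_lintegral_of_nonneg_ae (ae_of_all _ hp.nonneg)
    hp.measurable.aestronglyMeasurable, hp.lintegral_eq_one, ENNReal.toReal_one]

lemma intervalIntegrable (hp : AssumptionA p x₀) (a b : ℝ) : IntervalIntegrable p volume a b :=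
  hp.integrable.intervalIntegrable

end AssumptionA

/-- The distribution function with density `p`. -/
noncomputable def densityCDF (p : ℝ → ℝ) (t : ℝ) : ℝ := ∫ y in Set.Iic t, p y

section DensityCDF

variable {p : ℝ → ℝ} {x₀ : ℝ}

lemma densityCDF_sub (hp : AssumptionA p x₀) (s t : ℝ) :
    densityCDF p t - densityCDF p s = ∫ y in s..t, p y :=
  intervalIntegral.integral_Iic_sub_Iic hp.integrable.integrableOn hp.integrable.integrableOn

lemma densityCDF_mono (hp : AssumptionA p x₀) : Monotone (densityCDF p) := fun s t h => by
  have := densityCDF_sub hp s t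
  have h2 : 0 ≤ ∫ y in s..t, p y := intervalIntegral.integral_nonneg h fun y _ => hp.nonneg y
  linarith

lemma densityCDF_neg (hp : AssumptionA p x₀) (t : ℝ) :
    densityCDF p (-t) = 1 - densityCDF p t := by
  rw [densityCDF, densityCDF, ← hp.integral_eq_one,
    ← integral_add_compl measurableSet_Iic hp.integrable (s := Set.Iic t), Set.compl_Iic,
    ← integral_comp_neg_Ioi]
  simp [hp.symmetric]

lemma densityCDF_zero (hp : AssumptionA p x₀) : densityCDF p 0 = 1 / 2 := by
  have := densityCDF_neg hp 0
  rw [neg_zero] at this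
  linarith

lemma densityCDF_nonneg (hp : AssumptionA p x₀) (t : ℝ) : 0 ≤ densityCDF p t :=
  setIntegral_nonneg measurableSet_Iic fun y _ => hp.nonneg y

lemma densityCDF_le_one (hp : AssumptionA p x₀) (t : ℝ) : densityCDF p t ≤ 1 := by
  have := densityCDF_nonneg hp (-t)
  rw [densityCDF_neg hp] at this
  linarith

lemma continuous_densityCDF (hp : AssumptionA p x₀) : Continuous (densityCDF p) := by
  have h : densityCDF p = fun t => densityCDF p 0 + ∫ y in (0 : ℝ)..t, p y := by
    funext t
    rw [← densityCDF_sub hp]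
    ring
  rw [h]
  exact continuous_const.add (intervalIntegral.continuous_primitive hp.intervalIntegrable 0)

lemma measureReal_withDensity_Iic (hp : AssumptionA p x₀) (θ y : ℝ) :
    (volume.withDensity fun y => ENNReal.ofReal (p (y - θ))).real (Set.Iic y) =
      densityCDF p (y - θ) := by
  have hi : Integrable fun y => p (y - θ) := hp.integrable.comp_sub_right θ
  rw [measureReal_def, withDensity_apply _ measurableSet_Iic,
    ← ofReal_integral_eq_lintegral_ofReal hi.integrableOn (ae_of_all _ fun y => hp.nonneg _),
    ENNReal.toReal_ofReal (setIntegral_nonneg measurableSet_Iic fun y _ => hp.nonneg _), densityCDF]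
  have := (measurePreserving_sub_right volume θ).setIntegral_preimage_emb
    (MeasurableEquiv.subRight θ).measurableEmbedding p (Set.Iic (y - θ))
  rw [← this]
  congr 2
  ext z
  simp

lemma isProbabilityMeasure_withDensity (hp : AssumptionA p x₀) (θ : ℝ) :
    IsProbabilityMeasure (volume.withDensity fun y => ENNReal.ofReal (p (y - θ))) := by
  refine ⟨?_⟩
  rw [withDensity_apply _ MeasurableSet.univ, Measure.restrict_univ,
    lintegral_sub_right_eq_self (fun y => ENNReal.ofReal (p y)) θ, hp.lintegral_eq_one]

/-! #### Bounds in terms of the one-sided derivatives -/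

variable {p₀ p₁ p₂ B : ℝ}

lemma abs_iteratedDeriv_two_sub_le (hp : AssumptionA p x₀)
    (h2 : Tendsto (iteratedDeriv 2 p) (𝓝[>] 0) (𝓝 p₂))
    (hB : ∀ x ∈ Set.Ioo 0 x₀, |iteratedDeriv 3 p x| ≤ B) {x : ℝ} (h0 : 0 < x) (hx : x < x₀) :
    |iteratedDeriv 2 p x - p₂| ≤ B * x :=
  abs_sub_le_of_tendsto_zero h0
    (fun _ hy hyx => hp.hasDerivAt_iteratedDeriv (by norm_num) hy (hyx.trans_lt hx)) h2
    fun y hy hyx => hB y ⟨hy, hyx.trans_lt hx⟩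

lemma abs_deriv_sub_le (hp : AssumptionA p x₀) (hB0 : 0 ≤ B)
    (h1 : Tendsto (deriv p) (𝓝[>] 0) (𝓝 p₁))
    (h2 : Tendsto (iteratedDeriv 2 p) (𝓝[>] 0) (𝓝 p₂))
    (hB : ∀ x ∈ Set.Ioo 0 x₀, |iteratedDeriv 3 p x| ≤ B) {x : ℝ} (h0 : 0 < x) (hx : x < x₀) :
    |deriv p x - p₁ - p₂ * x| ≤ B * x ^ 2 := by
  have hl : Tendsto (fun y => deriv p y - p₂ * y) (𝓝[>] 0) (𝓝 p₁) := by
    have : Tendsto (fun y : ℝ => p₂ * y) (𝓝[>] 0) (𝓝 (p₂ * 0)) :=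
      ((continuous_const_mul p₂).tendsto 0).mono_left nhdsWithin_le_nhds
    simpa using h1.sub this
  have := abs_sub_le_of_tendsto_zero (g' := fun y => iteratedDeriv 2 p y - p₂ * 1) (K := B * x) h0
    (fun y hy hyx => by
      have h := hp.hasDerivAt_iteratedDeriv (k := 1) (by norm_num) hy (hyx.trans_lt hx)
      rw [iteratedDeriv_one] at h
      exact h.sub ((hasDerivAt_id' y).const_mul p₂)) hl
    (fun y hy hyx => by
      have := abs_iteratedDeriv_two_sub_le hp h2 hB hy (hyx.trans_lt hx)
      rw [mul_one]
      exact this.trans (by gcongr))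
  rw [sub_right_comm, pow_two, ← mul_assoc]
  exact this

lemma tendsto_density_zero (hp : AssumptionA p x₀) : Tendsto p (𝓝[>] 0) (𝓝 (p 0)) :=
  hp.continuousAt_zero.tendsto.mono_left nhdsWithin_le_nhds

lemma abs_density_sub_le (hp : AssumptionA p x₀) (hB0 : 0 ≤ B) (hp0 : p 0 = p₀)
    (h1 : Tendsto (deriv p) (𝓝[>] 0) (𝓝 p₁))
    (h2 : Tendsto (iteratedDeriv 2 p) (𝓝[>] 0) (𝓝 p₂))
    (hB : ∀ x ∈ Set.Ioo 0 x₀, |iteratedDeriv 3 p x| ≤ B) {x : ℝ} (h0 : 0 < x) (hx : x < x₀) :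
    |p x - (p₀ + p₁ * x + p₂ / 2 * x ^ 2)| ≤ B * x ^ 3 := by
  have hl : Tendsto (fun y => p y - (p₁ * y + p₂ / 2 * y ^ 2)) (𝓝[>] 0) (𝓝 p₀) := by
    have : Tendsto (fun y : ℝ => p₁ * y + p₂ / 2 * y ^ 2) (𝓝[>] 0)
        (𝓝 (p₁ * 0 + p₂ / 2 * 0 ^ 2)) :=
      ((by fun_prop : Continuous fun y : ℝ => p₁ * y + p₂ / 2 * y ^ 2).tendsto 0).mono_left
        nhdsWithin_le_nhds
    simpa [hp0] using (tendsto_density_zero hp).sub this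
  have := abs_sub_le_of_tendsto_zero (g' := fun y => deriv p y - p₁ - p₂ * y) (K := B * x ^ 2) h0
    (fun y hy hyx => by
      have h := hp.hasDerivAt_iteratedDeriv (k := 0) (by norm_num) hy (hyx.trans_lt hx)
      rw [iteratedDeriv_zero, zero_add, iteratedDeriv_one] at h
      refine (h.sub (((hasDerivAt_id' y).const_mul p₁).add
        ((hasDerivAt_pow 2 y).const_mul (p₂ / 2)))).congr_deriv ?_
      norm_num
      ring) hl
    (fun y hy hyx => by
      have := abs_deriv_sub_le hp hB0 h1 h2 hB hy (hyx.trans_lt hx)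
      exact this.trans (by gcongr))
  calc _ = _ := by congr 1; ring
    _ ≤ _ := this
    _ = _ := by ring

lemma abs_densityCDF_sub_le (hp : AssumptionA p x₀) (hB0 : 0 ≤ B) (hp0 : p 0 = p₀)
    (h1 : Tendsto (deriv p) (𝓝[>] 0) (𝓝 p₁))
    (h2 : Tendsto (iteratedDeriv 2 p) (𝓝[>] 0) (𝓝 p₂))
    (hB : ∀ x ∈ Set.Ioo 0 x₀, |iteratedDeriv 3 p x| ≤ B) {t : ℝ} (h0 : 0 ≤ t) (ht : t < x₀) :
    |densityCDF p t - 1 / 2 - (p₀ * t + p₁ / 2 * t ^ 2 + p₂ / 6 * t ^ 3)| ≤ B * t ^ 4 := by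
  have e1 : ∫ y in (0 : ℝ)..t, (p₀ + p₁ * y + p₂ / 2 * y ^ 2) =
      p₀ * t + p₁ / 2 * t ^ 2 + p₂ / 6 * t ^ 3 := by
    rw [intervalIntegral.integral_eq_sub_of_hasDerivAt
      (f := fun t => p₀ * t + p₁ / 2 * t ^ 2 + p₂ / 6 * t ^ 3) (fun y _ => ?_)
      (Continuous.intervalIntegrable (by fun_prop) _ _)]
    · ring
    · refine ((((hasDerivAt_id' y).const_mul p₀).add ((hasDerivAt_pow 2 y).const_mul (p₁ / 2))).add
        ((hasDerivAt_pow 3 y).const_mul (p₂ / 6))).congr_deriv ?_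
      norm_num
      ring
  have hi : IntervalIntegrable (fun y => p₀ + p₁ * y + p₂ / 2 * y ^ 2) volume 0 t :=
    Continuous.intervalIntegrable (by fun_prop) _ _
  rw [← densityCDF_zero hp, densityCDF_sub hp, ← e1,
    ← intervalIntegral.integral_sub (hp.intervalIntegrable _ _) hi, ← Real.norm_eq_abs]
  have := intervalIntegral.norm_integral_le_of_norm_le_const (a := (0 : ℝ)) (b := t)
    (C := B * t ^ 3) (f := fun y => p y - (p₀ + p₁ * y + p₂ / 2 * y ^ 2)) fun y hy => by
      rw [Set.uIoc_of_le h0] at hy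
      have := abs_density_sub_le hp hB0 hp0 h1 h2 hB hy.1 (hy.2.trans_lt ht)
      have hy0 := hy.1.le
      exact this.trans (by have := hy.2; gcongr)
  rw [sub_zero, abs_of_nonneg h0] at this
  exact this.trans_eq (by ring)

/-- A bound for the first derivative of the density to the right of the origin. -/
noncomputable def derivBound (p₁ p₂ x₀ B : ℝ) : ℝ := |p₁| + |p₂| * x₀ + B * x₀ ^ 2

/-- By symmetry `p x = p |x|`, so the Lipschitz bound to the right of `0` extends across the kink at
`0`. -/
lemma abs_density_sub_density_le (hp : AssumptionA p x₀) (hB0 : 0 ≤ B)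
    (h1 : Tendsto (deriv p) (𝓝[>] 0) (𝓝 p₁))
    (h2 : Tendsto (iteratedDeriv 2 p) (𝓝[>] 0) (𝓝 p₂))
    (hB : ∀ x ∈ Set.Ioo 0 x₀, |iteratedDeriv 3 p x| ≤ B) {x y : ℝ} (hx : |x| < x₀) (hy : |y| < x₀) :
    |p x - p y| ≤ derivBound p₁ p₂ x₀ B * |x - y| := by
  have hx₀ := hp.x₀_pos
  have hd : ∀ x, 0 < x → x < x₀ → |deriv p x| ≤ derivBound p₁ p₂ x₀ B := by
    intro x h0 hx
    have := abs_deriv_sub_le hp hB0 h1 h2 hB h0 hx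
    have e : deriv p x = (deriv p x - p₁ - p₂ * x) + p₁ + p₂ * x := by ring
    rw [e]
    calc _ ≤ |deriv p x - p₁ - p₂ * x| + |p₁| + |p₂ * x| := abs_add_three _ _ _
      _ ≤ B * x₀ ^ 2 + |p₁| + |p₂| * x₀ := by
        rw [abs_mul, abs_of_pos h0]
        gcongr
        exact this.trans (by gcongr)
      _ = _ := by rw [derivBound]; ring
  have hL : 0 ≤ derivBound p₁ p₂ x₀ B := by unfold derivBound; positivity
  have hhas : ∀ x, 0 < x → x < x₀ → HasDerivAt p (deriv p x) x := by
    intro x h0 hx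
    have h := hp.hasDerivAt_iteratedDeriv (k := 0) (by norm_num) h0 hx
    rwa [iteratedDeriv_zero, zero_add, iteratedDeriv_one] at h
  have key : ∀ x y, 0 ≤ x → x ≤ y → y < x₀ → |p x - p y| ≤ derivBound p₁ p₂ x₀ B * (y - x) := by
    intro x y h0 hxy hy
    rw [abs_sub_comm]
    rcases h0.eq_or_lt with rfl | h0
    · rcases hxy.eq_or_lt with rfl | hxy
      · simp
      rw [sub_zero]
      exact abs_sub_le_of_tendsto_zero hxy (fun z hz hzy => hhas z hz (hzy.trans_lt hy))
        (tendsto_density_zero hp) fun z hz hzy => hd z hz (hzy.trans_lt hy)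
    · have h := Convex.norm_image_sub_le_of_norm_hasDerivWithin_le (f := p) (f' := deriv p)
        (C := derivBound p₁ p₂ x₀ B) (s := Set.Icc x y) (x := x) (y := y)
        (fun z hz => (hhas z (h0.trans_le hz.1) (hz.2.trans_lt hy)).hasDerivWithinAt)
        (fun z hz => hd z (h0.trans_le hz.1) (hz.2.trans_lt hy)) (convex_Icc _ _) ⟨le_rfl, hxy⟩
        ⟨hxy, le_rfl⟩
      rwa [Real.norm_eq_abs, Real.norm_eq_abs, abs_of_nonneg (by linarith : 0 ≤ y - x)] at h
  have habs : ∀ x, p x = p |x| := fun x => by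
    rcases abs_cases x with ⟨h, -⟩ | ⟨h, -⟩ <;> rw [h]
    exact (hp.symmetric x).symm
  have h3 : |p x - p y| ≤ derivBound p₁ p₂ x₀ B * |(|x| - |y|)| := by
    rw [habs x, habs y]
    rcases le_total |x| |y| with h | h
    · rw [abs_sub_comm |x|, abs_of_nonneg (by linarith : 0 ≤ |y| - |x|)]
      exact key _ _ (abs_nonneg x) h hy
    · rw [abs_sub_comm, abs_of_nonneg (by linarith : 0 ≤ |x| - |y|)]
      exact key _ _ (abs_nonneg y) h hx
  exact h3.trans (mul_le_mul_of_nonneg_left (abs_abs_sub_abs_le_abs_sub x y) hL)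

/-- The half-width of a neighbourhood of the origin in which the density stays between
`p₀ / 2` and `3 p₀ / 2`. -/
noncomputable def centralRadius (p₀ p₁ p₂ x₀ B : ℝ) : ℝ :=
  min (x₀ / 3) (min (p₀ / (4 * (derivBound p₁ p₂ x₀ B + 1))) (1 / (9 * p₀)))

lemma centralRadius_pos (h0 : 0 < p₀) (hx : 0 < x₀) (hB : 0 ≤ B) :
    0 < centralRadius p₀ p₁ p₂ x₀ B := by
  have hL : 0 ≤ derivBound p₁ p₂ x₀ B := by unfold derivBound; positivity
  unfold centralRadius
  positivity

lemma two_mul_centralRadius_lt (hx : 0 < x₀) :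
    2 * centralRadius p₀ p₁ p₂ x₀ B < x₀ := by
  have : centralRadius p₀ p₁ p₂ x₀ B ≤ x₀ / 3 := min_le_left _ _
  linarith

lemma abs_density_sub_le_half (hp : AssumptionA p x₀) (hB0 : 0 ≤ B) (hp0 : p 0 = p₀)
    (h1 : Tendsto (deriv p) (𝓝[>] 0) (𝓝 p₁))
    (h2 : Tendsto (iteratedDeriv 2 p) (𝓝[>] 0) (𝓝 p₂))
    (hB : ∀ x ∈ Set.Ioo 0 x₀, |iteratedDeriv 3 p x| ≤ B) {x : ℝ}
    (hx : |x| ≤ 2 * centralRadius p₀ p₁ p₂ x₀ B) : |p x - p₀| ≤ p₀ / 2 := by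
  have hL : 0 ≤ derivBound p₁ p₂ x₀ B := by have := hp.x₀_pos; unfold derivBound; positivity
  have h0 : 0 < p₀ := hp0 ▸ hp.pos_zero
  have h := abs_density_sub_density_le hp hB0 h1 h2 hB (x := x) (y := 0)
    (hx.trans_lt (two_mul_centralRadius_lt hp.x₀_pos)) (by simpa using hp.x₀_pos)
  rw [hp0, sub_zero] at h
  -- The second entry of the minimum makes the Lipschitz constant times `2a` at most `p₀/2`, where
  -- `a` is the central radius.
  have h3 : centralRadius p₀ p₁ p₂ x₀ B ≤ p₀ / (4 * (derivBound p₁ p₂ x₀ B + 1)) :=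
    (min_le_right _ _).trans (min_le_left _ _)
  rw [le_div_iff₀ (by positivity)] at h3
  nlinarith [abs_nonneg x]

lemma density_mul_le_densityCDF_sub (hp : AssumptionA p x₀) (hB0 : 0 ≤ B) (hp0 : p 0 = p₀)
    (h1 : Tendsto (deriv p) (𝓝[>] 0) (𝓝 p₁))
    (h2 : Tendsto (iteratedDeriv 2 p) (𝓝[>] 0) (𝓝 p₂))
    (hB : ∀ x ∈ Set.Ioo 0 x₀, |iteratedDeriv 3 p x| ≤ B) {s t : ℝ} (hst : s ≤ t)
    (hs : -(2 * centralRadius p₀ p₁ p₂ x₀ B) ≤ s) (ht : t ≤ 2 * centralRadius p₀ p₁ p₂ x₀ B) :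
    p₀ / 2 * (t - s) ≤ densityCDF p t - densityCDF p s ∧
      densityCDF p t - densityCDF p s ≤ 3 * p₀ / 2 * (t - s) := by
  have hb : ∀ y ∈ Set.Icc s t, |p y - p₀| ≤ p₀ / 2 := fun y hy =>
    abs_density_sub_le_half hp hB0 hp0 h1 h2 hB (abs_le.2 ⟨hs.trans hy.1, hy.2.trans ht⟩)
  rw [densityCDF_sub hp]
  constructor
  · have := intervalIntegral.integral_mono_on hst (intervalIntegrable_const (c := p₀ / 2))
      (hp.intervalIntegrable s t) fun y hy => by linarith [(abs_le.1 (hb y hy)).1]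
    rw [intervalIntegral.integral_const, smul_eq_mul, mul_comm] at this
    exact this
  · have := intervalIntegral.integral_mono_on hst (hp.intervalIntegrable s t)
      (intervalIntegrable_const (c := 3 * p₀ / 2)) fun y hy => by linarith [(abs_le.1 (hb y hy)).2]
    rw [intervalIntegral.integral_const, smul_eq_mul, mul_comm (t - s)] at this
    exact this

/-- The constant in the bound for the asymmetry of the distribution function. -/
noncomputable def asymmetryBound (p₀ p₁ p₂ x₀ B : ℝ) : ℝ :=
  8 * derivBound p₁ p₂ x₀ B / p₀ ^ 2 + 4 / (p₀ * centralRadius p₀ p₁ p₂ x₀ B) ^ 2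

/-- Let `u` be the left increment, `L` the Lipschitz constant, `a` the central radius. For `s ≤ a`
the asymmetry is at most `2Ls²`, while `u ≥ p₀ s/2`: this is the first term of `asymmetryBound`. For
`s > a` the asymmetry is at most `1`, while `u ≥ p₀ a/2`: this is the second. -/
lemma abs_densityCDF_asymmetry_le (hp : AssumptionA p x₀) (hB0 : 0 ≤ B) (hp0 : p 0 = p₀)
    (h1 : Tendsto (deriv p) (𝓝[>] 0) (𝓝 p₁))
    (h2 : Tendsto (iteratedDeriv 2 p) (𝓝[>] 0) (𝓝 p₂))
    (hB : ∀ x ∈ Set.Ioo 0 x₀, |iteratedDeriv 3 p x| ≤ B) {s t : ℝ} (hs : 0 ≤ s)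
    (ht : |t| ≤ centralRadius p₀ p₁ p₂ x₀ B) :
    |(densityCDF p (t + s) - densityCDF p t) - (densityCDF p t - densityCDF p (t - s))| ≤
      asymmetryBound p₀ p₁ p₂ x₀ B * (densityCDF p t - densityCDF p (t - s)) ^ 2 := by
  set a := centralRadius p₀ p₁ p₂ x₀ B with ha
  set L := derivBound p₁ p₂ x₀ B with hLdef
  set u := densityCDF p t - densityCDF p (t - s) with hu
  have h0 : 0 < p₀ := hp0 ▸ hp.pos_zero
  have ha0 : 0 < a := centralRadius_pos h0 hp.x₀_pos hB0
  have hax : 2 * a < x₀ := two_mul_centralRadius_lt hp.x₀_pos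
  have hL : 0 ≤ L := by have := hp.x₀_pos; rw [hLdef]; unfold derivBound; positivity
  obtain ⟨ht1, ht2⟩ := abs_le.1 ht
  have hK : asymmetryBound p₀ p₁ p₂ x₀ B * u ^ 2 = 8 * L / p₀ ^ 2 * u ^ 2 + 4 / (p₀ * a) ^ 2 * u ^ 2 := by
    rw [asymmetryBound]; ring
  have hK1 : 0 ≤ 8 * L / p₀ ^ 2 * u ^ 2 := by positivity
  have hK2 : 0 ≤ 4 / (p₀ * a) ^ 2 * u ^ 2 := by positivity
  rw [hK]
  rcases le_or_gt s a with hsa | hsa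
  · have hus := (density_mul_le_densityCDF_sub hp hB0 hp0 h1 h2 hB (s := t - s) (t := t)
      (by linarith) (by linarith) (by linarith)).1
    rw [sub_sub_cancel] at hus
    have e1 : densityCDF p (t + s) - densityCDF p t = ∫ r in (0 : ℝ)..s, p (t + r) := by
      rw [densityCDF_sub hp, intervalIntegral.integral_comp_add_left (fun y => p y) t, add_zero]
    have e2 : u = ∫ r in (0 : ℝ)..s, p (t - r) := by
      rw [hu, densityCDF_sub hp, intervalIntegral.integral_comp_sub_left (fun y => p y) t, sub_zero]
    have i1 : IntervalIntegrable (fun r => p (t + r)) volume 0 s :=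
      (hp.integrable.comp_add_left t).intervalIntegrable
    have i2 : IntervalIntegrable (fun r => p (t - r)) volume 0 s :=
      (hp.integrable.comp_sub_left t).intervalIntegrable
    have hb : |(densityCDF p (t + s) - densityCDF p t) - u| ≤ 2 * L * s ^ 2 := by
      rw [e1, e2, ← intervalIntegral.integral_sub i1 i2, ← Real.norm_eq_abs]
      have := intervalIntegral.norm_integral_le_of_norm_le_const (a := (0 : ℝ)) (b := s)
        (C := L * (2 * s)) (f := fun r => p (t + r) - p (t - r)) fun r hr => by
          rw [Set.uIoc_of_le hs] at hr
          have h := abs_density_sub_density_le hp hB0 h1 h2 hB (x := t + r) (y := t - r)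
            (abs_lt.2 ⟨by linarith [hr.1], by linarith [hr.2]⟩)
            (abs_lt.2 ⟨by linarith [hr.2], by linarith [hr.1]⟩)
          refine h.trans (mul_le_mul_of_nonneg_left ?_ hL)
          rw [show t + r - (t - r) = 2 * r by ring, abs_of_pos (by linarith [hr.1])]
          linarith [hr.2]
      rw [sub_zero, abs_of_nonneg hs] at this
      exact this.trans_eq (by ring)
    have h5 : 2 * L * s ^ 2 ≤ 8 * L / p₀ ^ 2 * u ^ 2 := by
      have : (p₀ / 2 * s) ^ 2 ≤ u ^ 2 := pow_le_pow_left₀ (by positivity) hus 2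
      calc 2 * L * s ^ 2 = 8 * L / p₀ ^ 2 * (p₀ / 2 * s) ^ 2 := by field_simp; ring
        _ ≤ _ := by gcongr
    linarith
  · have hus := (density_mul_le_densityCDF_sub hp hB0 hp0 h1 h2 hB (s := t - a) (t := t)
      (by linarith) (by linarith) (by linarith)).1
    rw [sub_sub_cancel] at hus
    have hm := densityCDF_mono hp (show t - s ≤ t - a by linarith)
    have hu2 : p₀ / 2 * a ≤ u := by linarith
    have h5 : 1 ≤ 4 / (p₀ * a) ^ 2 * u ^ 2 := by
      have : (p₀ / 2 * a) ^ 2 ≤ u ^ 2 := pow_le_pow_left₀ (by positivity) hu2 2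
      calc (1 : ℝ) = 4 / (p₀ * a) ^ 2 * (p₀ / 2 * a) ^ 2 := by field_simp; norm_num
        _ ≤ _ := by gcongr
    have g1 := densityCDF_mono hp (show t ≤ t + s by linarith)
    have g2 := densityCDF_mono hp (show t - s ≤ t by linarith)
    have g3 := densityCDF_le_one hp (t + s)
    have g4 := densityCDF_nonneg hp (t - s)
    have : |(densityCDF p (t + s) - densityCDF p t) - u| ≤ 1 := by
      rw [abs_le]; constructor <;> linarith
    linarith

end DensityCDF

/-! ### Change of variables in the expansion -/

lemma abs_le_mul_of_mem_uIcc {f f' : ℝ → ℝ} {x y K : ℝ} (hf : ∀ z, HasDerivAt f (f' z) z)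
    (hx : f x = 0) (hK : ∀ z ∈ Set.uIcc x y, |f' z| ≤ K) {z : ℝ} (hz : z ∈ Set.uIcc x y) :
    |f z| ≤ K * |y - x| := by
  have h := Convex.norm_image_sub_le_of_norm_hasDerivWithin_le (f := f) (f' := f') (C := K)
    (s := Set.uIcc x y) (x := x) (y := z) (fun w _ => (hf w).hasDerivWithinAt) hK
    (convex_uIcc _ _) Set.left_mem_uIcc hz
  rw [hx, sub_zero] at h
  have hK0 : 0 ≤ K := (abs_nonneg _).trans (hK x Set.left_mem_uIcc)
  exact h.trans (mul_le_mul_of_nonneg_left (Set.abs_sub_left_of_mem_uIcc hz) hK0)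

/-- The derivatives of `Φ` are `φ`, `-xφ`, `(x²-1)φ`; the one-step bound is applied three times, so
the remainder constant is not divided by `6`. -/
lemma abs_stdNormalCDF_taylor_le {x y S : ℝ}
    (hS : ∀ z ∈ Set.uIcc x y, |(z ^ 2 - 1) * stdPhi z| ≤ S) :
    |stdNormalCDF y - stdNormalCDF x - (y - x) * stdPhi x + (y - x) ^ 2 * (x * stdPhi x) / 2| ≤
      S * |y - x| ^ 3 := by
  have hsub : ∀ z, HasDerivAt (fun z : ℝ => z - x) 1 z := fun z => (hasDerivAt_id' z).sub_const x
  have d2 : ∀ z, HasDerivAt (fun z => x * stdPhi x - z * stdPhi z) ((z ^ 2 - 1) * stdPhi z) z :=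
    fun z => (((hasDerivAt_id' z).mul (hasDerivAt_stdPhi z)).const_sub _).congr_deriv (by ring)
  have d1 : ∀ z, HasDerivAt (fun z => stdPhi z - stdPhi x + (z - x) * (x * stdPhi x))
      (x * stdPhi x - z * stdPhi z) z := fun z =>
    (((hasDerivAt_stdPhi z).sub_const _).add ((hsub z).mul_const _)).congr_deriv (by ring)
  have d0 : ∀ z, HasDerivAt (fun z => stdNormalCDF z - stdNormalCDF x - (z - x) * stdPhi x
      + (z - x) ^ 2 * (x * stdPhi x) / 2) (stdPhi z - stdPhi x + (z - x) * (x * stdPhi x)) z :=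
    fun z => (((hasDerivAt_stdNormalCDF z).sub_const _).sub ((hsub z).mul_const _) |>.add
      ((((hsub z).pow 2).mul_const _).div_const 2)).congr_deriv (by norm_num; ring)
  have b2 := fun z (hz : z ∈ Set.uIcc x y) => abs_le_mul_of_mem_uIcc d2 (by ring) hS hz
  have b1 := fun z (hz : z ∈ Set.uIcc x y) => abs_le_mul_of_mem_uIcc d1 (by ring) b2 hz
  have b0 := abs_le_mul_of_mem_uIcc d0 (by ring) b1 Set.right_mem_uIcc
  exact b0.trans_eq (by ring)

lemma abs_cubic_mul_stdPhi_sub_le {x y S : ℝ}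
    (hS : ∀ z ∈ Set.uIcc x y, |(3 - z ^ 4) * stdPhi z| ≤ S) :
    |(y ^ 3 + 3 * y) * stdPhi y - (x ^ 3 + 3 * x) * stdPhi x| ≤ S * |y - x| := by
  have d : ∀ z, HasDerivAt (fun z => (z ^ 3 + 3 * z) * stdPhi z - (x ^ 3 + 3 * x) * stdPhi x)
      ((3 - z ^ 4) * stdPhi z) z := by
    intro z
    have h1 : HasDerivAt (fun y : ℝ => y ^ 3 + 3 * y) (3 * z ^ 2 + 3) z :=
      ((hasDerivAt_pow 3 z).add ((hasDerivAt_id' z).const_mul 3)).congr_deriv (by norm_num)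
    exact ((h1.mul (hasDerivAt_stdPhi z)).sub_const _).congr_deriv (by ring)
  exact abs_le_mul_of_mem_uIcc d (by ring) hS Set.right_mem_uIcc

/-- Here `r` stands for `1/√n`. Expand `Φ` to second order about `x` and keep `d = α x² r` in the
quadratic term: this yields `-α² x⁵/2`. Each remainder is `r³` times a power of `x` times a Gaussian
factor, hence bounded. -/
lemma exists_abs_expansion_sub_le (α β γ c : ℝ) (hγ : 0 ≤ γ) (hc : 0 ≤ c) :
    ∃ C, 0 < C ∧ ∀ r x y : ℝ, 0 < r → r ≤ 1 → 0 ≤ x → x * r ≤ c → x / 2 ≤ y →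
      |y - (x + α * x ^ 2 * r + β * x ^ 3 * r ^ 2)| ≤ γ * x ^ 4 * r ^ 3 →
      |(stdNormalCDF y + r ^ 2 * ((y ^ 3 + 3 * y) * stdPhi y / 4)) -
        (stdNormalCDF x + r * (α * x ^ 2 * stdPhi x) +
          r ^ 2 * ((β * x ^ 3 - α ^ 2 * x ^ 5 / 2 + (x ^ 3 + 3 * x) / 4) * stdPhi x))| ≤
        C * r ^ 3 := by
  obtain ⟨E2, he2, H2⟩ := exists_pow_mul_exp_le' 2 (c := 1 / 8) (by norm_num)
  obtain ⟨E4, he4, H4⟩ := exists_pow_mul_exp_le' 4 (c := 1 / 8) (by norm_num)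
  obtain ⟨E6, he6, H6⟩ := exists_pow_mul_exp_le' 6 (c := 1 / 8) (by norm_num)
  obtain ⟨E8, he8, H8⟩ := exists_pow_mul_exp_le' 8 (c := 1 / 8) (by norm_num)
  -- Since `x r ≤ c`, a surplus factor `x r` can be traded for `c`. This produces the constants in
  -- `|d - α x² r| ≤ b x³ r²`, `|d| ≤ A x² r` and `y ≤ M x`.
  obtain ⟨b, hb⟩ : ∃ b, b = |β| + γ * c := ⟨_, rfl⟩
  have hb0 : 0 ≤ b := by rw [hb]; positivity
  obtain ⟨A, hA⟩ : ∃ A, A = |α| + b * c := ⟨_, rfl⟩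
  have hA0 : 0 ≤ A := by rw [hA]; positivity
  have hαA : |α| ≤ A := by rw [hA]; linarith [mul_nonneg hb0 hc]
  obtain ⟨M, hM⟩ : ∃ M, M = 1 + A * c := ⟨_, rfl⟩
  have hM1 : 1 ≤ M := by rw [hM]; linarith [mul_nonneg hA0 hc]
  refine ⟨A ^ 3 * (M ^ 2 * E8 + E6) + γ * E4 + A * b * E6 + A * (3 * E2 + M ^ 4 * E6) + 1,
    by positivity, fun r x y hr0 hr1 hx hxr hxy hy => ?_⟩
  obtain ⟨e, he⟩ : ∃ e, e = Real.exp (-(1 / 8 * x ^ 2)) := ⟨_, rfl⟩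
  have he0 : 0 < e := he ▸ Real.exp_pos _
  have H2' := H2 x hx
  have H4' := H4 x hx
  have H6' := H6 x hx
  have H8' := H8 x hx
  rw [← he] at H2' H4' H6' H8'
  obtain ⟨d, hd⟩ : ∃ d, d = y - x := ⟨_, rfl⟩
  have hd1 : |d - α * x ^ 2 * r| ≤ b * x ^ 3 * r ^ 2 := by
    calc |d - α * x ^ 2 * r|
        = |(y - (x + α * x ^ 2 * r + β * x ^ 3 * r ^ 2)) + β * x ^ 3 * r ^ 2| := by
          rw [hd]; congr 1; ring
      _ ≤ γ * x ^ 4 * r ^ 3 + |β| * x ^ 3 * r ^ 2 := by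
          refine (abs_add_le _ _).trans (add_le_add hy (le_of_eq ?_))
          rw [abs_mul, abs_mul, abs_of_nonneg (by positivity : 0 ≤ x ^ 3),
            abs_of_nonneg (by positivity : 0 ≤ r ^ 2)]
      _ = γ * x ^ 3 * r ^ 2 * (x * r) + |β| * x ^ 3 * r ^ 2 := by ring
      _ ≤ γ * x ^ 3 * r ^ 2 * c + |β| * x ^ 3 * r ^ 2 := by gcongr
      _ = _ := by rw [hb]; ring
  have hd2 : |d| ≤ A * x ^ 2 * r := by
    calc |d| = |(d - α * x ^ 2 * r) + α * x ^ 2 * r| := by congr 1; ring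
      _ ≤ b * x ^ 3 * r ^ 2 + |α| * x ^ 2 * r := by
          refine (abs_add_le _ _).trans (add_le_add hd1 (le_of_eq ?_))
          rw [abs_mul, abs_mul, abs_of_nonneg (by positivity : 0 ≤ x ^ 2), abs_of_pos hr0]
      _ = b * x ^ 2 * r * (x * r) + |α| * x ^ 2 * r := by ring
      _ ≤ b * x ^ 2 * r * c + |α| * x ^ 2 * r := by gcongr
      _ = _ := by rw [hA]; ring
  have hyM : y ≤ M * x := by
    have h1 : y ≤ x + A * x * (x * r) := by linarith [(abs_le.1 hd2).2]
    have h2 : A * x * (x * r) ≤ A * x * c := by gcongr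
    rw [hM]; linarith
  have hz : ∀ z ∈ Set.uIcc x y, x / 2 ≤ z ∧ z ≤ M * x := by
    intro z hz
    rcases Set.mem_uIcc.1 hz with h | h
    · exact ⟨by linarith [h.1], h.2.trans hyM⟩
    · exact ⟨hxy.trans h.1, h.2.trans (le_mul_of_one_le_left hx hM1)⟩
  -- All intermediate points are at least `x/2`, so `φ` is at most `exp(-x²/8)` there.
  have hphi : ∀ z, x / 2 ≤ z → stdPhi z ≤ e := fun z hz => by
    rw [he]
    refine (stdPhi_le_exp z).trans (Real.exp_le_exp.2 ?_)
    nlinarith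
  have hphix : stdPhi x ≤ e := hphi x (by linarith)
  have hphi0 := stdPhi_nonneg x
  have t1 := abs_stdNormalCDF_taylor_le (x := x) (y := y) (S := ((M * x) ^ 2 + 1) * e) fun z hz' => by
    obtain ⟨h1, h2⟩ := hz z hz'
    have hz0 : 0 ≤ z := by linarith
    rw [abs_mul, abs_of_nonneg (stdPhi_nonneg z)]
    refine mul_le_mul ?_ (hphi z h1) (stdPhi_nonneg z) (by positivity)
    have : z ^ 2 ≤ (M * x) ^ 2 := by gcongr
    rw [abs_le]; constructor <;> nlinarith [sq_nonneg z, sq_nonneg (M * x)]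
  have t4 := abs_cubic_mul_stdPhi_sub_le (x := x) (y := y) (S := (3 + (M * x) ^ 4) * e)
    fun z hz' => by
      obtain ⟨h1, h2⟩ := hz z hz'
      have hz0 : 0 ≤ z := by linarith
      rw [abs_mul, abs_of_nonneg (stdPhi_nonneg z)]
      refine mul_le_mul ?_ (hphi z h1) (stdPhi_nonneg z) (by positivity)
      have : z ^ 4 ≤ (M * x) ^ 4 := by gcongr
      have h4 : 0 ≤ z ^ 4 := by positivity
      rw [abs_le]; constructor <;> linarith
  rw [← hd] at t1 t4
  have b1 : ((M * x) ^ 2 + 1) * e * |d| ^ 3 ≤ A ^ 3 * (M ^ 2 * E8 + E6) * r ^ 3 := by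
    calc _ ≤ ((M * x) ^ 2 + 1) * e * (A * x ^ 2 * r) ^ 3 := by gcongr
      _ = A ^ 3 * (M ^ 2 * (x ^ 8 * e) + x ^ 6 * e) * r ^ 3 := by ring
      _ ≤ _ := by gcongr
  have b2 : |(y - (x + α * x ^ 2 * r + β * x ^ 3 * r ^ 2)) * stdPhi x| ≤ γ * E4 * r ^ 3 := by
    rw [abs_mul, abs_of_nonneg hphi0]
    calc _ ≤ γ * x ^ 4 * r ^ 3 * e := by gcongr
      _ = γ * (x ^ 4 * e) * r ^ 3 := by ring
      _ ≤ _ := by gcongr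
  have b3 : |(d ^ 2 - (α * x ^ 2 * r) ^ 2) * (x * stdPhi x) / 2| ≤ A * b * E6 * r ^ 3 := by
    have h1 : |d + α * x ^ 2 * r| ≤ 2 * (A * x ^ 2 * r) := by
      refine (abs_add_le _ _).trans ?_
      rw [abs_mul, abs_mul, abs_of_nonneg (by positivity : 0 ≤ x ^ 2), abs_of_pos hr0]
      have : |α| * x ^ 2 * r ≤ A * x ^ 2 * r := by gcongr
      linarith
    rw [sq_sub_sq, abs_div, abs_two, abs_mul, abs_mul, abs_of_nonneg (by positivity : 0 ≤ x * stdPhi x)]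
    calc _ ≤ 2 * (A * x ^ 2 * r) * (b * x ^ 3 * r ^ 2) * (x * e) / 2 := by gcongr
      _ = A * b * (x ^ 6 * e) * r ^ 3 := by ring
      _ ≤ _ := by gcongr
  have b4 : |r ^ 2 * (((y ^ 3 + 3 * y) * stdPhi y - (x ^ 3 + 3 * x) * stdPhi x) / 4)| ≤
      A * (3 * E2 + M ^ 4 * E6) * r ^ 3 := by
    rw [abs_mul, abs_of_nonneg (by positivity : 0 ≤ r ^ 2), abs_div,
      abs_of_pos (by norm_num : (0 : ℝ) < 4)]
    calc _ ≤ r ^ 2 * ((3 + (M * x) ^ 4) * e * |d| / 4) := by gcongr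
      _ ≤ r ^ 2 * ((3 + (M * x) ^ 4) * e * |d| / 1) := by gcongr; norm_num
      _ ≤ r ^ 2 * ((3 + (M * x) ^ 4) * e * (A * x ^ 2 * r) / 1) := by gcongr
      _ = A * (3 * (x ^ 2 * e) + M ^ 4 * (x ^ 6 * e)) * r ^ 3 := by ring
      _ ≤ _ := by gcongr
  have b1' := t1.trans b1
  have hdec : (stdNormalCDF y + r ^ 2 * ((y ^ 3 + 3 * y) * stdPhi y / 4)) -
        (stdNormalCDF x + r * (α * x ^ 2 * stdPhi x) +
          r ^ 2 * ((β * x ^ 3 - α ^ 2 * x ^ 5 / 2 + (x ^ 3 + 3 * x) / 4) * stdPhi x)) =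
      (stdNormalCDF y - stdNormalCDF x - d * stdPhi x + d ^ 2 * (x * stdPhi x) / 2) +
      (y - (x + α * x ^ 2 * r + β * x ^ 3 * r ^ 2)) * stdPhi x -
      (d ^ 2 - (α * x ^ 2 * r) ^ 2) * (x * stdPhi x) / 2 +
      r ^ 2 * (((y ^ 3 + 3 * y) * stdPhi y - (x ^ 3 + 3 * x) * stdPhi x) / 4) := by
    rw [hd]; ring
  rw [hdec]
  have hr3 : 0 < r ^ 3 := by positivity
  rw [abs_le] at b1' b2 b3 b4 ⊢
  constructor <;> linarith [b1'.1, b2.1, b3.1, b4.1, b1'.2, b2.2, b3.2, b4.2]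

/-- Outside a neighbourhood of the origin of radius of order `1 / r` the expansion is trivial. -/
lemma exists_abs_expansion_sub_one_le (α β c : ℝ) (hc : 0 < c) :
    ∃ C, 0 < C ∧ ∀ r x : ℝ, 0 < r → r ≤ 1 → c ≤ x * r →
      |(stdNormalCDF x + r * (α * x ^ 2 * stdPhi x) +
          r ^ 2 * ((β * x ^ 3 - α ^ 2 * x ^ 5 / 2 + (x ^ 3 + 3 * x) / 4) * stdPhi x)) - 1| ≤
        C * r ^ 3 := by
  obtain ⟨E2, he2, H2⟩ := exists_pow_mul_exp_le' 2 (c := 1 / 2) (by norm_num)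
  obtain ⟨E3, he3, H3⟩ := exists_pow_mul_exp_le' 3 (c := 1 / 2) (by norm_num)
  obtain ⟨E4, he4, H4⟩ := exists_pow_mul_exp_le' 4 (c := 1 / 2) (by norm_num)
  obtain ⟨E6, he6, H6⟩ := exists_pow_mul_exp_le' 6 (c := 1 / 2) (by norm_num)
  refine ⟨(E3 + 1) / c ^ 3 + |α| * E4 / c ^ 2
    + ((|β| + 1) * E4 + α ^ 2 * E6 + E2) / c, by positivity, fun r x hr0 hr1 hx => ?_⟩
  have hx0 : 0 < x := pos_of_mul_pos_left (hc.trans_le hx) hr0.le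
  have H2' := H2 x hx0.le
  have H3' := H3 x hx0.le
  have H4' := H4 x hx0.le
  have H6' := H6 x hx0.le
  set e := Real.exp (-(1 / 2 * x ^ 2)) with he
  have he0 : 0 < e := Real.exp_pos _
  have hphi : stdPhi x ≤ e := by
    have := stdPhi_le_exp x
    rwa [show x ^ 2 / 2 = 1 / 2 * x ^ 2 by ring] at this
  have hphi0 := stdPhi_nonneg x
  -- Multiplying by powers of `x r / c ≥ 1` supplies the missing powers of `r`; the extra powers of
  -- `x` are absorbed by the Gaussian factor.
  have hone : 1 ≤ x * r / c := (one_le_div hc).2 hx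
  have b1 : |stdNormalCDF x - 1| ≤ (E3 + 1) / c ^ 3 * r ^ 3 := by
    have h1 : 1 - stdNormalCDF x ≤ (E3 + 1) / x ^ 3 := by
      rw [le_div_iff₀ (by positivity)]
      rcases le_or_gt 1 x with h | h
      · have := one_sub_stdNormalCDF_le h
        rw [show x ^ 2 / 2 = 1 / 2 * x ^ 2 by ring] at this
        have h3 : (1 - stdNormalCDF x) * x ^ 3 ≤ e * x ^ 3 := by gcongr
        linarith
      · have h3 : x ^ 3 ≤ 1 := pow_le_one₀ hx0.le h.le
        have h4 : 1 - stdNormalCDF x ≤ 1 := by linarith [stdNormalCDF_nonneg x]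
        have h5 : (1 - stdNormalCDF x) * x ^ 3 ≤ 1 * 1 :=
          mul_le_mul h4 h3 (by positivity) (by norm_num)
        linarith
    rw [abs_sub_comm, abs_of_nonneg (by linarith [stdNormalCDF_le_one x])]
    calc _ ≤ (E3 + 1) / x ^ 3 * 1 ^ 3 := by rw [one_pow, mul_one]; exact h1
      _ ≤ (E3 + 1) / x ^ 3 * (x * r / c) ^ 3 := by gcongr
      _ = _ := by field_simp
  have b2 : |r * (α * x ^ 2 * stdPhi x)| ≤ |α| * E4 / c ^ 2 * r ^ 3 := by
    rw [abs_mul, abs_mul, abs_mul, abs_of_pos hr0, abs_of_nonneg hphi0,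
      abs_of_nonneg (by positivity : 0 ≤ x ^ 2)]
    calc _ ≤ r * (|α| * x ^ 2 * e) * 1 ^ 2 := by rw [one_pow, mul_one]; gcongr
      _ ≤ r * (|α| * x ^ 2 * e) * (x * r / c) ^ 2 := by gcongr
      _ = |α| * (x ^ 4 * e) / c ^ 2 * r ^ 3 := by field_simp
      _ ≤ _ := by gcongr
  have b3 : |r ^ 2 * ((β * x ^ 3 - α ^ 2 * x ^ 5 / 2 + (x ^ 3 + 3 * x) / 4) * stdPhi x)| ≤
      ((|β| + 1) * E4 + α ^ 2 * E6 + E2) / c * r ^ 3 := by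
    have hp : |β * x ^ 3 - α ^ 2 * x ^ 5 / 2 + (x ^ 3 + 3 * x) / 4| ≤
        (|β| + 1) * x ^ 3 + α ^ 2 * x ^ 5 + x := by
      have g1 := mul_le_mul_of_nonneg_right (le_abs_self β) (by positivity : 0 ≤ x ^ 3)
      have g2 := mul_le_mul_of_nonneg_right (neg_abs_le β) (by positivity : 0 ≤ x ^ 3)
      have g3 : 0 ≤ α ^ 2 * x ^ 5 := by positivity
      have g4 : 0 ≤ x ^ 3 := by positivity
      rw [abs_le]; constructor <;> linarith
    rw [abs_mul, abs_mul, abs_of_nonneg hphi0, abs_of_nonneg (by positivity : 0 ≤ r ^ 2)]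
    calc _ ≤ r ^ 2 * (((|β| + 1) * x ^ 3 + α ^ 2 * x ^ 5 + x) * e) * 1 := by rw [mul_one]; gcongr
      _ ≤ r ^ 2 * (((|β| + 1) * x ^ 3 + α ^ 2 * x ^ 5 + x) * e) * (x * r / c) := by gcongr
      _ = ((|β| + 1) * (x ^ 4 * e) + α ^ 2 * (x ^ 6 * e) + x ^ 2 * e) / c * r ^ 3 := by
          field_simp
      _ ≤ _ := by gcongr
  calc _ = |(stdNormalCDF x - 1) + r * (α * x ^ 2 * stdPhi x)
        + r ^ 2 * ((β * x ^ 3 - α ^ 2 * x ^ 5 / 2 + (x ^ 3 + 3 * x) / 4) * stdPhi x)| := by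
        congr 1; ring
    _ ≤ _ := abs_add_three _ _ _
    _ ≤ _ := add_le_add (add_le_add b1 b2) b3
    _ = _ := by ring

/-! ### The expansion for the distribution function with density `p` -/

/-- The constants and the hypotheses on the density that determine the expansion. -/
structure DensityData (p : ℝ → ℝ) (p₀ p₁ p₂ x₀ B : ℝ) : Prop where
  assumption : AssumptionA p x₀
  apply_zero : p 0 = p₀
  deriv_zero : Tendsto (deriv p) (𝓝[>] 0) (𝓝 p₁)
  deriv_two_zero : Tendsto (iteratedDeriv 2 p) (𝓝[>] 0) (𝓝 p₂)
  bound : ∀ x ∈ Set.Ioo 0 x₀, |iteratedDeriv 3 p x| ≤ B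

section

variable {p₀ p₁ p₂ x₀ B : ℝ}

lemma f₁_neg (x : ℝ) : f₁ p₀ p₁ (-x) = -f₁ p₀ p₁ x := by
  simp only [f₁, abs_neg, stdPhi_neg]; ring

lemma f₂_neg (x : ℝ) : f₂ p₀ p₁ p₂ (-x) = -f₂ p₀ p₁ p₂ x := by
  simp only [f₂, stdPhi_neg]; ring

lemma expansion_eq (h0 : 0 < p₀) {x n : ℝ} (hx : 0 ≤ x) (hn : 0 < n) :
    stdNormalCDF x + f₁ p₀ p₁ x / √n + f₂ p₀ p₁ p₂ x / n =
      stdNormalCDF x + (√n)⁻¹ * (p₁ / (4 * p₀ ^ 2) * x ^ 2 * stdPhi x) +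
        (√n)⁻¹ ^ 2 * ((p₂ / (24 * p₀ ^ 3) * x ^ 3 - (p₁ / (4 * p₀ ^ 2)) ^ 2 * x ^ 5 / 2
          + (x ^ 3 + 3 * x) / 4) * stdPhi x) := by
  have hs : (√n)⁻¹ ^ 2 = n⁻¹ := by rw [inv_pow, Real.sq_sqrt hn.le]
  rw [f₁, f₂, abs_of_nonneg hx, hs]
  field_simp
  ring

lemma exists_abs_medianBeta_densityCDF_central_le (h0 : 0 < p₀) (hx₀ : 0 < x₀) (hB : 0 ≤ B) :
    ∃ C, 0 < C ∧ ∀ p, DensityData p p₀ p₁ p₂ x₀ B → ∀ k : ℕ, 1 ≤ k → ∀ x : ℝ, 0 ≤ x →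
      x / (2 * p₀ * √(2 * k)) ≤ centralRadius p₀ p₁ p₂ x₀ B →
      |medianBeta k (densityCDF p (x / (2 * p₀ * √(2 * k)))) -
        (stdNormalCDF x + f₁ p₀ p₁ x / √(2 * k) + f₂ p₀ p₁ p₂ x / (2 * k))| ≤
        C / √(2 * k) ^ 3 := by
  set a := centralRadius p₀ p₁ p₂ x₀ B with ha
  have ha0 : 0 < a := centralRadius_pos h0 hx₀ hB
  obtain ⟨C₁, hC₁, H₁⟩ := exists_abs_medianBeta_sub_le
  obtain ⟨C₂, hC₂, H₂⟩ := exists_abs_expansion_sub_le (p₁ / (4 * p₀ ^ 2)) (p₂ / (24 * p₀ ^ 3))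
    (B / (8 * p₀ ^ 4)) (2 * p₀ * a) (by positivity) (by positivity)
  refine ⟨C₁ + C₂, by positivity, fun p hp k hk x hx hxa => ?_⟩
  have hk0 : (1 : ℝ) ≤ k := by exact_mod_cast hk
  set n : ℝ := 2 * k with hn
  have hn1 : 1 ≤ n := by linarith
  have hn0 : 0 < n := by linarith
  have hs : √n ^ 2 = n := Real.sq_sqrt hn0.le
  have hs0 : 0 < √n := Real.sqrt_pos.2 hn0
  have hs1 : 1 ≤ √n := Real.one_le_sqrt.2 hn1
  set t := x / (2 * p₀ * √n) with ht
  have ht0 : 0 ≤ t := by positivity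
  have hxt : x = 2 * p₀ * √n * t := by rw [ht]; field_simp
  have htx₀ : t < x₀ := by
    have := two_mul_centralRadius_lt (p₀ := p₀) (p₁ := p₁) (p₂ := p₂) (B := B) hx₀
    rw [← ha] at this
    linarith
  set F := densityCDF p t with hF
  set y := √n * (2 * F - 1) with hy
  have hF1 : F ≤ 1 := densityCDF_le_one hp.assumption t
  have htay := abs_densityCDF_sub_le hp.assumption hB hp.apply_zero hp.deriv_zero
    hp.deriv_two_zero hp.bound ht0 htx₀
  have hlow := (density_mul_le_densityCDF_sub hp.assumption hB hp.apply_zero hp.deriv_zero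
    hp.deriv_two_zero hp.bound ht0 (by rw [← ha]; linarith) (by rw [← ha]; linarith)).1
  rw [densityCDF_zero hp.assumption, sub_zero] at hlow
  rw [← hF] at htay hlow
  have hyx : x / 2 ≤ y := by
    have : √n * (2 * (p₀ / 2 * t)) ≤ √n * (2 * (F - 1 / 2)) := by gcongr
    rw [hy, hxt]
    linarith
  have hy0 : 0 ≤ y := by linarith
  have hyn : y ≤ √n := by
    have : √n * (2 * F - 1) ≤ √n * 1 := by gcongr; linarith
    rw [hy]; linarith
  have hFy : F = 1 / 2 + y / (2 * √n) := by rw [hy]; field_simp; ring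
  have h1 := H₁ k hk y hy0 (by rw [← hn]; exact hyn)
  rw [← hn, ← hFy] at h1
  have h2 := H₂ (√n)⁻¹ x y (by positivity) (inv_le_one_of_one_le₀ hs1) hx (by
      rw [hxt]
      calc 2 * p₀ * √n * t * (√n)⁻¹ = 2 * p₀ * t := by field_simp
        _ ≤ _ := by gcongr) hyx (by
      have e : y - (x + p₁ / (4 * p₀ ^ 2) * x ^ 2 * (√n)⁻¹ + p₂ / (24 * p₀ ^ 3) * x ^ 3 * (√n)⁻¹ ^ 2)
          = 2 * √n * (F - 1 / 2 - (p₀ * t + p₁ / 2 * t ^ 2 + p₂ / 6 * t ^ 3)) := by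
        rw [hy, hxt]; field_simp; ring
      rw [e, abs_mul, abs_of_pos (by positivity : 0 < 2 * √n)]
      calc _ ≤ 2 * √n * (B * t ^ 4) := by gcongr
        _ = _ := by rw [hxt]; field_simp; ring)
  rw [← expansion_eq h0 hx hn0] at h2
  have e3 : uniformExpansion n y = stdNormalCDF y + (√n)⁻¹ ^ 2 * ((y ^ 3 + 3 * y) * stdPhi y / 4) := by
    rw [uniformExpansion, inv_pow, hs]
    field_simp
  rw [← e3] at h2
  have e4 : C₁ / n ^ 2 ≤ C₁ / √n ^ 3 := by
    have : n ^ 2 = √n ^ 3 * √n := by nth_rw 1 [← hs]; ring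
    rw [this]
    gcongr
    exact le_mul_of_one_le_right (by positivity) hs1
  calc _ ≤ _ := abs_sub_le _ (uniformExpansion n y) _
    _ ≤ C₁ / √n ^ 3 + C₂ * (√n)⁻¹ ^ 3 := add_le_add (h1.trans e4) h2
    _ = _ := by rw [inv_pow]; field_simp

/-- By monotonicity the value lies between that at the edge of the central region and `1`. At the
edge the central estimate applies, and the expansion is within `O(n^(-3/2))` of `1` both there and
at `x`. -/
lemma exists_abs_medianBeta_densityCDF_outer_le (h0 : 0 < p₀) (hx₀ : 0 < x₀) (hB : 0 ≤ B) :
    ∃ C, 0 < C ∧ ∀ p, DensityData p p₀ p₁ p₂ x₀ B → ∀ k : ℕ, 1 ≤ k → ∀ x : ℝ, 0 ≤ x →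
      centralRadius p₀ p₁ p₂ x₀ B ≤ x / (2 * p₀ * √(2 * k)) →
      |medianBeta k (densityCDF p (x / (2 * p₀ * √(2 * k)))) -
        (stdNormalCDF x + f₁ p₀ p₁ x / √(2 * k) + f₂ p₀ p₁ p₂ x / (2 * k))| ≤
        C / √(2 * k) ^ 3 := by
  set a := centralRadius p₀ p₁ p₂ x₀ B with ha
  have ha0 : 0 < a := centralRadius_pos h0 hx₀ hB
  obtain ⟨C₁, hC₁, H₁⟩ := exists_abs_medianBeta_densityCDF_central_le (p₁ := p₁) (p₂ := p₂) h0 hx₀ hB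
  obtain ⟨C₂, hC₂, H₂⟩ := exists_abs_expansion_sub_one_le (p₁ / (4 * p₀ ^ 2)) (p₂ / (24 * p₀ ^ 3))
    (2 * p₀ * a) (by positivity)
  refine ⟨C₁ + 2 * C₂, by positivity, fun p hp k hk x hx hxa => ?_⟩
  have hk0 : (1 : ℝ) ≤ k := by exact_mod_cast hk
  have h1 := H₁ p hp k hk
  set n : ℝ := 2 * k with hn
  have hn1 : 1 ≤ n := by linarith
  have hn0 : 0 < n := by linarith
  have hs0 : 0 < √n := Real.sqrt_pos.2 hn0
  have hs1 : 1 ≤ √n := Real.one_le_sqrt.2 hn1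
  have hr1 : (√n)⁻¹ ≤ 1 := inv_le_one_of_one_le₀ hs1
  set x' := 2 * p₀ * √n * a with hx'
  have hx'0 : 0 ≤ x' := by positivity
  have hx'a : x' / (2 * p₀ * √n) = a := by rw [hx']; field_simp
  have h1' := h1 x' hx'0 hx'a.le
  rw [hx'a] at h1'
  have g2 := H₂ (√n)⁻¹ x' (by positivity) hr1 (by rw [hx']; field_simp; exact le_rfl)
  have g3 := H₂ (√n)⁻¹ x (by positivity) hr1 (by
    rw [le_div_iff₀ (by positivity)] at hxa
    calc 2 * p₀ * a = a * (2 * p₀ * √n) * (√n)⁻¹ := by field_simp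
      _ ≤ _ := by gcongr)
  rw [← expansion_eq h0 hx'0 hn0] at g2
  rw [← expansion_eq h0 hx hn0] at g3
  have m0 : ∀ t, densityCDF p t ∈ Set.Icc (0 : ℝ) 1 := fun t =>
    ⟨densityCDF_nonneg hp.assumption t, densityCDF_le_one hp.assumption t⟩
  have j1 := medianBeta_mono k (m0 a) (m0 (x / (2 * p₀ * √n))) (densityCDF_mono hp.assumption hxa)
  have j2 := medianBeta_mono k (m0 (x / (2 * p₀ * √n))) (by simp : (1 : ℝ) ∈ Set.Icc (0 : ℝ) 1)
    (m0 _).2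
  rw [medianBeta_one] at j2
  have e : (C₁ + 2 * C₂) / √n ^ 3 = C₁ / √n ^ 3 + C₂ * (√n)⁻¹ ^ 3 + C₂ * (√n)⁻¹ ^ 3 := by
    rw [inv_pow]; field_simp; ring
  have hpos : 0 < C₁ / √n ^ 3 := by positivity
  have hpos2 : 0 < C₂ * (√n)⁻¹ ^ 3 := by positivity
  rw [e]
  rw [abs_le] at h1' g2 g3 ⊢
  constructor <;> linarith [h1'.1, h1'.2, g2.1, g2.2, g3.1, g3.2]

/-- Negative `x` reduce to positive ones: `F(-t) = 1 - F(t)`, `medianBeta k (1 - q) = 1 - medianBeta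
k q`, and `f₁`, `f₂` are odd. -/
lemma exists_abs_medianBeta_densityCDF_le (h0 : 0 < p₀) (hx₀ : 0 < x₀) (hB : 0 ≤ B) :
    ∃ C, 0 < C ∧ ∀ p, DensityData p p₀ p₁ p₂ x₀ B → ∀ k : ℕ, 1 ≤ k → ∀ x : ℝ,
      |medianBeta k (densityCDF p (x / (2 * p₀ * √(2 * k)))) -
        (stdNormalCDF x + f₁ p₀ p₁ x / √(2 * k) + f₂ p₀ p₁ p₂ x / (2 * k))| ≤
        C / √(2 * k) ^ 3 := by
  obtain ⟨C₁, hC₁, H₁⟩ := exists_abs_medianBeta_densityCDF_central_le (p₁ := p₁) (p₂ := p₂) h0 hx₀ hB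
  obtain ⟨C₂, hC₂, H₂⟩ := exists_abs_medianBeta_densityCDF_outer_le (p₁ := p₁) (p₂ := p₂) h0 hx₀ hB
  refine ⟨max C₁ C₂, by positivity, fun p hp k hk x => ?_⟩
  have key : ∀ x : ℝ, 0 ≤ x → |medianBeta k (densityCDF p (x / (2 * p₀ * √(2 * k)))) -
      (stdNormalCDF x + f₁ p₀ p₁ x / √(2 * k) + f₂ p₀ p₁ p₂ x / (2 * k))| ≤
        max C₁ C₂ / √(2 * k) ^ 3 := by
    intro x hx
    rcases le_total (x / (2 * p₀ * √(2 * k))) (centralRadius p₀ p₁ p₂ x₀ B) with h | h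
    · refine (H₁ p hp k hk x hx h).trans ?_
      gcongr
      exact le_max_left _ _
    · refine (H₂ p hp k hk x hx h).trans ?_
      gcongr
      exact le_max_right _ _
  rcases le_total 0 x with hx | hx
  · exact key x hx
  · have h := key (-x) (by linarith)
    rw [neg_div, densityCDF_neg hp.assumption, medianBeta_one_sub, stdNormalCDF_neg, f₁_neg,
      f₂_neg, ← abs_neg] at h
    refine le_of_eq_of_le ?_ h
    congr 1
    ring

/-! ### Comparison of samples of even and odd size -/

lemma exists_abs_even_sub_medianBeta_le (h0 : 0 < p₀) (hx₀ : 0 < x₀) (hB : 0 ≤ B) :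
    ∃ C, 0 < C ∧ ∀ p, DensityData p p₀ p₁ p₂ x₀ B → ∀ θ t : ℝ, ∀ k : ℕ, 1 ≤ k →
      ∀ (Ω : Type*) [MeasurableSpace Ω] (P : Measure Ω) [IsProbabilityMeasure P]
        (X : Fin (2 * k) → Ω → ℝ), (∀ i, Measurable (X i)) → iIndepFun X P →
        (∀ i, P.map (X i) = volume.withDensity (fun y => ENNReal.ofReal (p (y - θ)))) →
        |P.real {ω | sampleMedian (fun i => X i ω) ≤ θ + t} - medianBeta k (densityCDF p t)| ≤
          C / √(2 * k) ^ 3 := by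
  set a := centralRadius p₀ p₁ p₂ x₀ B with ha
  have ha0 : 0 < a := centralRadius_pos h0 hx₀ hB
  set K := asymmetryBound p₀ p₁ p₂ x₀ B with hK
  have hK0 : 0 ≤ K := by
    have : 0 ≤ derivBound p₁ p₂ x₀ B := by unfold derivBound; positivity
    rw [hK]; unfold asymmetryBound; positivity
  -- For `|t| > a` the error is at most `(4q(1-q))^k`, which will be bounded by `exp(-(p₀a)² k)`;
  -- the exponent is `(p₀a)²/2` times `(√n)² = 2k`.
  obtain ⟨E, hE, HE⟩ := exists_pow_mul_exp_le' 3 (c := (p₀ * a) ^ 2 / 2) (by positivity)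
  refine ⟨16 * (K + 1) + E, by positivity, fun p hp θ t k hk Ω _ P _ X hX hi hμ => ?_⟩
  have hk0 : (1 : ℝ) ≤ k := by exact_mod_cast hk
  have hcb := centralBinom_le k
  set n : ℝ := 2 * k with hn
  have hn0 : 0 < n := by linarith
  have hs : √n ^ 2 = n := Real.sq_sqrt hn0.le
  have hs0 : 0 < √n := Real.sqrt_pos.2 hn0
  have hprob := isProbabilityMeasure_withDensity hp.assumption θ
  have hF : ∀ y, (volume.withDensity fun y => ENNReal.ofReal (p (y - θ))).real (Set.Iic y) =
      densityCDF p (y - θ) := measureReal_withDensity_Iic hp.assumption θ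
  have hcont : Continuous fun y =>
      (volume.withDensity fun y => ENNReal.ofReal (p (y - θ))).real (Set.Iic y) := by
    simp only [hF]
    exact (continuous_densityCDF hp.assumption).comp (continuous_sub_right θ)
  have hq : (volume.withDensity fun y => ENNReal.ofReal (p (y - θ))).real (Set.Iic (θ + t)) =
      densityCDF p t := by rw [hF, add_sub_cancel_left]
  set q := densityCDF p t with hqdef
  have hcb' : (k.centralBinom : ℝ) * (1 / 4) ^ k * √n ≤ 1 := by
    have h1 : (k.centralBinom : ℝ) * √n ≤ 4 ^ k := by
      refine le_trans ?_ hcb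
      gcongr
      linarith
    calc (k.centralBinom : ℝ) * (1 / 4) ^ k * √n = ((k.centralBinom : ℝ) * √n) * (1 / 4) ^ k := by ring
      _ ≤ 4 ^ k * (1 / 4) ^ k := by gcongr
      _ = 1 := by rw [← mul_pow]; norm_num
  rcases le_or_gt |t| a with hta | hta
  · obtain ⟨ht1, ht2⟩ := abs_le.1 hta
    -- The third entry of `centralRadius` gives `F a ≤ 1/2 + (3p₀/2) · 1/(9p₀) = 2/3`.
    have hq23 : q ≤ 2 / 3 := by
      have hm : q ≤ densityCDF p a := densityCDF_mono hp.assumption ht2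
      have hup := (density_mul_le_densityCDF_sub hp.assumption hB hp.apply_zero hp.deriv_zero
        hp.deriv_two_zero hp.bound ha0.le (by rw [← ha]; linarith) (by rw [← ha]; linarith)).2
      rw [densityCDF_zero hp.assumption, sub_zero] at hup
      have h9 : a ≤ 1 / (9 * p₀) := (min_le_right _ _).trans (min_le_right _ _)
      rw [le_div_iff₀ (by positivity)] at h9
      linarith
    have h := abs_measureReal_sampleMedian_le_sub_le hk hX hi hμ (t := θ + t)
      (ε := 8 * (K + 1) / k * (1 / 4) ^ k) fun ν hν1 hν2 =>
        abs_setIntegral_one_sub_cdf_pow_sub_le hk hcont hν2 hK0 (by rw [hq]; exact hq23)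
          fun s hs => by
            rw [hq, hF, hF, show θ + t + s - θ = t + s by ring, show θ + t - s - θ = t - s by ring]
            exact abs_densityCDF_asymmetry_le hp.assumption hB hp.apply_zero hp.deriv_zero
              hp.deriv_two_zero hp.bound hs hta
    rw [hq] at h
    refine h.trans ?_
    rw [le_div_iff₀ (by positivity)]
    calc (k.centralBinom : ℝ) * (8 * (K + 1) / k * (1 / 4) ^ k) * √n ^ 3
        = 8 * (K + 1) / k * √n ^ 2 * ((k.centralBinom : ℝ) * (1 / 4) ^ k * √n) := by ring
      _ ≤ 8 * (K + 1) / k * √n ^ 2 * 1 := by gcongr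
      _ = 16 * (K + 1) := by rw [hs, hn]; field_simp; ring
      _ ≤ _ := by linarith
  · have h := abs_measureReal_sampleMedian_le_sub_le hk hX hi hμ (t := θ + t)
      (ε := (q * (1 - q)) ^ k) fun ν hν1 hν2 => by
        have := abs_setIntegral_one_sub_cdf_pow_sub_le_pow hν2 (θ + t)
        rwa [hq] at this ⊢
    rw [hq] at h
    refine h.trans ?_
    have hlow := (density_mul_le_densityCDF_sub hp.assumption hB hp.apply_zero hp.deriv_zero
        hp.deriv_two_zero hp.bound ha0.le (by rw [← ha]; linarith) (by rw [← ha]; linarith)).1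
    rw [densityCDF_zero hp.assumption, sub_zero] at hlow
    have hδ : (p₀ / 2 * a) ^ 2 ≤ (q - 1 / 2) ^ 2 := by
      rcases lt_or_ge t 0 with ht | ht
      · rw [abs_of_neg ht] at hta
        have hm := densityCDF_mono hp.assumption (show t ≤ -a by linarith)
        rw [densityCDF_neg hp.assumption, ← hqdef] at hm
        rw [← neg_sq (q - 1 / 2)]
        exact pow_le_pow_left₀ (by positivity) (by linarith) 2
      · rw [abs_of_nonneg ht] at hta
        have hm := densityCDF_mono hp.assumption hta.le
        rw [← hqdef] at hm
        exact pow_le_pow_left₀ (by positivity) (by linarith) 2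
    have hq0 : 0 ≤ q * (1 - q) := mul_nonneg (densityCDF_nonneg hp.assumption t)
      (by linarith [densityCDF_le_one hp.assumption t])
    -- Use `4q(1-q) = 1 - 4(q - 1/2)²` and `|q - 1/2| ≥ p₀a/2`.
    have h4 : 4 * (q * (1 - q)) ≤ Real.exp (-(p₀ * a) ^ 2) := by
      refine le_trans ?_ (Real.one_sub_le_exp_neg ((p₀ * a) ^ 2) |>.trans_eq (by simp))
      nlinarith
    have h5 : (4 * (q * (1 - q))) ^ k ≤ Real.exp (-((p₀ * a) ^ 2 / 2 * √n ^ 2)) := by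
      refine (pow_le_pow_left₀ (by positivity) h4 k).trans_eq ?_
      rw [← Real.exp_nat_mul, hs, hn]
      ring_nf
    have hcb4 : (k.centralBinom : ℝ) ≤ 4 ^ k := by
      refine le_trans (le_mul_of_one_le_right (by positivity) ?_) hcb
      exact Real.one_le_sqrt.2 (by linarith)
    rw [le_div_iff₀ (by positivity)]
    calc (k.centralBinom : ℝ) * (q * (1 - q)) ^ k * √n ^ 3
        ≤ 4 ^ k * (q * (1 - q)) ^ k * √n ^ 3 := by gcongr
      _ = √n ^ 3 * (4 * (q * (1 - q))) ^ k := by rw [mul_pow 4 (q * (1 - q))]; ring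
      _ ≤ √n ^ 3 * Real.exp (-((p₀ * a) ^ 2 / 2 * √n ^ 2)) := by gcongr
      _ ≤ E := HE √n hs0.le
      _ ≤ _ := by linarith

end

/-! ### Passage from powers of `√n` to powers of `m`, and the final assembly. -/

lemma div_sqrt_pow_three_le {C : ℝ} (hC : 0 ≤ C) {m n : ℝ} (hm : 0 < m) (hmn : m ≤ 2 * n) :
    C / √n ^ 3 ≤ 4 * C / m ^ (3 / 2 : ℝ) := by
  have hn : 0 < n := by linarith
  have hs : 0 < √n := Real.sqrt_pos.2 hn
  have e : m ^ (3 / 2 : ℝ) = √m ^ 3 := by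
    rw [Real.sqrt_eq_rpow, ← Real.rpow_natCast, ← Real.rpow_mul hm.le]
    norm_num
  have h1 : √m ^ 3 ≤ 4 * √n ^ 3 := by
    have h2 : √m ≤ √2 * √n := by
      rw [← Real.sqrt_mul (by norm_num)]
      exact Real.sqrt_le_sqrt hmn
    have h3 : √2 ≤ 3 / 2 := by
      rw [Real.sqrt_le_left (by norm_num)]
      norm_num
    calc √m ^ 3 ≤ (3 / 2 * √n) ^ 3 := by
          gcongr
          exact h2.trans (by gcongr)
      _ = 27 / 8 * √n ^ 3 := by ring
      _ ≤ _ := by gcongr; norm_num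
  rw [e, div_le_div_iff₀ (by positivity) (by positivity)]
  nlinarith

end MedianExpansion

theorem proposition2p1 (p₀ p₁ p₂ x₀ B : ℝ) :
    ∃ C₁ : ℝ, ∀ p : ℝ → ℝ, MedianExpansion.AssumptionA p x₀ →
      p 0 = p₀ →
      Tendsto (deriv p) (𝓝[>] 0) (𝓝 p₁) →
      Tendsto (iteratedDeriv 2 p) (𝓝[>] 0) (𝓝 p₂) →
      (∀ x ∈ Set.Ioo 0 x₀, |iteratedDeriv 3 p x| ≤ B) →
      ∀ (θ : ℝ) (m : ℕ), 2 ≤ m →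
      ∀ (Ω : Type*) [MeasurableSpace Ω] (P : Measure Ω) [IsProbabilityMeasure P]
        (X : Fin m → Ω → ℝ),
        (∀ i, Measurable (X i)) →
        iIndepFun X P →
        (∀ i, P.map (X i) = volume.withDensity (fun y => ENNReal.ofReal (p (y - θ)))) →
        ∀ x : ℝ,
          |P.real {ω | 2 * p₀ * √(MedianExpansion.mStar m : ℝ) *
                (MedianExpansion.sampleMedian (fun i => X i ω) - θ) ≤ x}
              - MedianExpansion.stdNormalCDF x
              - MedianExpansion.f₁ p₀ p₁ x / √(MedianExpansion.mStar m : ℝ)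
              - MedianExpansion.f₂ p₀ p₁ p₂ x / (MedianExpansion.mStar m : ℝ)|
            ≤ C₁ / (m : ℝ) ^ (3 / 2 : ℝ) := by
  -- Otherwise no density satisfies the hypotheses, and any constant serves.
  by_cases hpos : 0 < p₀ ∧ 0 < x₀ ∧ 0 ≤ B
  swap
  · refine ⟨0, fun p hA hp0 _ _ hB => absurd ⟨hp0 ▸ hA.pos_zero, hA.x₀_pos, ?_⟩ hpos⟩
    exact (abs_nonneg _).trans
      (hB (x₀ / 2) ⟨by linarith [hA.x₀_pos], by linarith [hA.x₀_pos]⟩)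
  obtain ⟨h0, hx₀, hB0⟩ := hpos
  obtain ⟨C₁, hC₁, H₁⟩ :=
    MedianExpansion.exists_abs_medianBeta_densityCDF_le (p₁ := p₁) (p₂ := p₂) h0 hx₀ hB0
  obtain ⟨C₂, hC₂, H₂⟩ :=
    MedianExpansion.exists_abs_even_sub_medianBeta_le (p₁ := p₁) (p₂ := p₂) h0 hx₀ hB0
  refine ⟨4 * (C₁ + C₂), fun p hA hp0 hp1 hp2 hB θ m hm Ω _ P _ X hX hi hμ x => ?_⟩
  have hp : MedianExpansion.DensityData p p₀ p₁ p₂ x₀ B := ⟨hA, hp0, hp1, hp2, hB⟩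
  obtain ⟨k, hk⟩ := Nat.even_or_odd' m
  have hk1 : 1 ≤ k := by omega
  have hk1' : (1 : ℝ) ≤ k := by exact_mod_cast hk1
  have hstar : (MedianExpansion.mStar m : ℝ) = 2 * k := by
    have : MedianExpansion.mStar m = 2 * k := by unfold MedianExpansion.mStar; omega
    rw [this]; push_cast; ring
  rw [hstar]
  -- `m ≤ 2k + 1 ≤ 4k`, so `m` and `m*` are comparable.
  have hmk : (m : ℝ) ≤ 2 * (2 * k) := by
    have : m ≤ 2 * (2 * k) := by omega
    exact_mod_cast this
  have hm0 : (0 : ℝ) < m := by exact_mod_cast (by omega : 0 < m)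
  refine le_trans ?_ (MedianExpansion.div_sqrt_pow_three_le (by positivity) hm0 hmk)
  have hs0 : 0 < √(2 * (k : ℝ)) := Real.sqrt_pos.2 (by positivity)
  set t := x / (2 * p₀ * √(2 * k)) with ht
  have hset : {ω | 2 * p₀ * √(2 * (k : ℝ)) *
      (MedianExpansion.sampleMedian (fun i => X i ω) - θ) ≤ x} =
      {ω | MedianExpansion.sampleMedian (fun i => X i ω) ≤ θ + t} := by
    ext ω
    rw [Set.mem_ofPred_eq, Set.mem_ofPred_eq, ht, ← sub_le_iff_le_add', le_div_iff₀' (by positivity)]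
  rw [hset]
  have hcmp : |P.real {ω | MedianExpansion.sampleMedian (fun i => X i ω) ≤ θ + t}
      - MedianExpansion.medianBeta k (MedianExpansion.densityCDF p t)| ≤ C₂ / √(2 * k) ^ 3 := by
    -- In the odd case the comparison error is exactly zero.
    rcases hk with rfl | rfl
    · exact H₂ p hp θ t k hk1 Ω P X hX hi hμ
    · have := MedianExpansion.isProbabilityMeasure_withDensity hA θ
      rw [MedianExpansion.measureReal_sampleMedian_le_of_odd hX hi hμ,
        MedianExpansion.measureReal_withDensity_Iic hA, add_sub_cancel_left, sub_self, abs_zero]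
      positivity
  have hexp := H₁ p hp k hk1 x
  rw [← ht] at hexp
  rw [sub_sub, sub_sub, ← add_assoc]
  calc _ ≤ _ := abs_sub_le _ _ _
    _ ≤ _ := add_le_add hcmp hexp
    _ = _ := by ring
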